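/- Let $d\ge 0$. Observations are $Y_i=X_i+\varepsilon_i\in\mathbb R^d$, where $(X_i)_{i\ge1}$ is a stationary sequence (for instance a stationary Markov chain), $R^\star$ is the law of $(X_1,X_2)$, and $(\varepsilon_i)_{i\ge1}$ is i.i.d., independent of $(X_i)$, with characteristic function $\phi^\star$; $\mathbb P^\star$ is the underlying probability. For a probability distribution $R$ on $\mathbb R^d\times\mathbb R^d$ put $\Phi_R(z_1,z_2)=\int e^{z_1^Tx_1+z_2^Tx_2}\,dR(x_1,x_2)$, $z_1,z_2\in\mathbb C^d$. Let $\mathcal S$ be a compact neighborhood of $0$ in $\mathbb R^{2d}$ such that $(t_1,t_2)\in\mathcal S$ implies $(t_1,0)\in\mathcal S$ and $(0,t_2)\in\mathcal S$, and let $w$ be positive on $\mathcal S$ and integrable over $\mathcal S$. Put $$M(R)=\int_{\mathcal S}\bigl|\Phi_{R^\star}(it_1,it_2)\Phi_R(it_1,0)\Phi_R(0,it_2)-\Phi_R(it_1,it_2)\Phi_{R^\star}(it_1,0)\Phi_{R^\star}(0,it_2)\bigr|^2\,|\phi^\star(t_1)\phi^\star(t_2)|^2\,w(t_1,t_2)\,dt_1dt_2.$$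 For each $n$ let $\widehat\Phi_n:\mathbb R^d\times\mathbb R^d\to\mathbb C$ be an estimator, based on the observations, of the characteristic function of $(Y_1,Y_2)$ (measurable in its argument), and put $$M_n(R)=\int_{\mathcal S}\bigl|\widehat\Phi_n(t_1,t_2)\Phi_R(it_1,0)\Phi_R(0,it_2)-\Phi_R(it_1,it_2)\widehat\Phi_n(t_1,0)\widehat\Phi_n(0,t_2)\bigr|^2w(t_1,t_2)\,dt_1dt_2,$$ $$Z_n(t_1,t_2)=\sqrt n\,\bigl(\widehat\Phi_n(t_1,t_2)-\Phi_{R^\star}(it_1,it_2)\phi^\star(t_1)\phi^\star(t_2)\bigr).$$ Let $0<\rho<2$ and let $\mathcal R$ be a set of probability distributions on $\mathbb R^d\times\mathbb R^d$ containing $R^\star$ such that, for every $R\in\mathcal R$: (a) for each of the two marginals $\mu$ of $R$ there are $A,B>0$ with $\int e^{u^Tx}\,d\mu(x)\le A e^{B\|u\|^\rho}$ for all $u\in\mathbb R^d$; (b) for every $z_0\in\mathbb C^d$, $z\mapsto\Phi_R(z_0,z)$ or $z\mapsto\Phi_R(z,z_0)$ is not the null function. For $n\ge1$ let $\widehat R_n\in\mathcal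 R$ satisfy $M_n(\widehat R_n)=\inf_{R\in\mathcal R}M_n(R)$. Assume that $\sup_{(t_1,t_2)\in\mathcal S}|Z_n(t_1,t_2)|=O_{\mathbb P^\star}(1)$. Then $$M(\widehat R_n)=O_{\mathbb P^\star}(n^{-1/2}).$$ If moreover $\mathcal R$ is compact for the weak convergence topology and every $R\in\mathcal R$ has two equal marginals (as the law of two consecutive states of a stationary chain does), then, for every distance $D$ that metrizes weak convergence on $\mathcal R$, $D(\widehat R_n,\mathcal R^\star)\to0$ in $\mathbb P^\star$-probability, where $\mathcal R^\star$ is the set of $R\in\mathcal R$ equal to $R^\star$ up to translation, i.e. such that for some $m\in\mathbb R^d$, if $(X_1,X_2)$ has law $R$, then $(X_1-m,X_2-m)$ has law $R^\star$. -/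

import Mathlib

open MeasureTheory ProbabilityTheory Filter Topology
open scoped ENNReal

noncomputable section

namespace HiddenTranslation

/-- The state space `ℝ^d` with its Euclidean norm, Borel sets and Lebesgue measure. -/
abbrev E (d : ℕ) : Type := EuclideanSpace ℝ (Fin d)

/-- Probability distributions on `ℝ^d × ℝ^d`, with the topology of weak convergence. -/
abbrev PairLaw (d : ℕ) : Type := ProbabilityMeasure (E d × E d)

/-- The translation model `Y i = X i + ε i`: the hidden sequence `X` is stationary, `Rstar` is the
law of two consecutive hidden states, and the noise `ε` is i.i.d. with law `Pstar` and independent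
of `X`. -/
structure IsTranslationModel {d : ℕ} {Ω : Type*} [MeasurableSpace Ω] (Pr : Measure Ω)
    (X ε : ℕ → Ω → E d) (Rstar : PairLaw d) (Pstar : ProbabilityMeasure (E d)) : Prop where
  measurable_X : ∀ i, Measurable (X i)
  measurable_ε : ∀ i, Measurable (ε i)
  stationary : Pr.map (fun ω i => X (i + 1) ω) = Pr.map (fun ω i => X i ω)
  law_X : HasLaw (fun ω => (X 0 ω, X 1 ω)) (Rstar : Measure (E d × E d)) Pr
  law_ε : ∀ i, HasLaw (ε i) (Pstar : Measure (E d)) Pr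
  indep_ε : iIndepFun ε Pr
  indep_X_ε : IndepFun (fun ω i => X i ω) (fun ω i => ε i ω) Pr

/-- The observed sequence. -/
def obs {d : ℕ} {Ω : Type*} (X ε : ℕ → Ω → E d) (ω : Ω) : ℕ → E d := fun i => X i ω + ε i ω

/-- `Φ_R(z₁, z₂) = ∫ exp (z₁ᵀ x₁ + z₂ᵀ x₂) dR(x₁, x₂)` for `z₁, z₂ ∈ ℂ^d`. -/
def Phi {d : ℕ} (R : PairLaw d) (z₁ z₂ : Fin d → ℂ) : ℂ :=
  ∫ x : E d × E d, Complex.exp (∑ j, z₁ j * (x.1 j : ℂ) + ∑ j, z₂ j * (x.2 j : ℂ))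
    ∂(R : Measure (E d × E d))

/-- The vector `i t ∈ ℂ^d` for `t ∈ ℝ^d`. -/
def im {d : ℕ} (t : E d) : Fin d → ℂ := fun j => Complex.I * (t j : ℂ)

/-- The class `𝓜_ρ` of measures whose Laplace transform is bounded by `A exp (B ‖u‖ ^ ρ)`. -/
def LightTail {d : ℕ} (ρ : ℝ) (μ : Measure (E d)) : Prop :=
  ∃ A B : ℝ, 0 < A ∧ 0 < B ∧ ∀ u : E d,
    ∫⁻ x, ENNReal.ofReal (Real.exp (inner ℝ u x)) ∂μ ≤
      ENNReal.ofReal (A * Real.exp (B * ‖u‖ ^ ρ))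

/-- The dependency assumption: for every `z₀ ∈ ℂ^d`, `z ↦ Φ_R(z₀, z)` is not the null function or
`z ↦ Φ_R(z, z₀)` is not the null function. -/
def Dependency {d : ℕ} (R : PairLaw d) : Prop :=
  ∀ z₀ : Fin d → ℂ, (∃ z, Phi R z₀ z ≠ 0) ∨ (∃ z, Phi R z z₀ ≠ 0)

/-- `R = R'` up to translation: for some `m ∈ ℝ^d`, if `(X₁, X₂)` has law `R` then
`(X₁ - m, X₂ - m)` has law `R'`. -/
def EqUpToTranslation {d : ℕ} (R R' : PairLaw d) : Prop :=
  ∃ m : E d, (R : Measure (E d × E d)).map (fun x => (x.1 - m, x.2 - m)) =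
    (R' : Measure (E d × E d))

/-- The population criterion `M(R)`. -/
def crit {d : ℕ} (S : Set (E d × E d)) (w : E d × E d → ℝ) (Rstar : PairLaw d)
    (Pstar : ProbabilityMeasure (E d)) (R : PairLaw d) : ℝ≥0∞ :=
  ∫⁻ t in S,
    ‖Phi Rstar (im t.1) (im t.2) * Phi R (im t.1) 0 * Phi R 0 (im t.2)
      - Phi R (im t.1) (im t.2) * Phi Rstar (im t.1) 0 * Phi Rstar 0 (im t.2)‖ₑ ^ 2
    * ‖charFun (Pstar : Measure (E d)) t.1 * charFun (Pstar : Measure (E d)) t.2‖ₑ ^ 2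
    * ENNReal.ofReal (w t)

/-- The empirical criterion `M_n(R)`, in which `ψ` is the value of the estimator of the
characteristic function of two consecutive observations. -/
def empCrit {d : ℕ} (S : Set (E d × E d)) (w : E d × E d → ℝ) (ψ : E d × E d → ℂ)
    (R : PairLaw d) : ℝ≥0∞ :=
  ∫⁻ t in S,
    ‖ψ t * Phi R (im t.1) 0 * Phi R 0 (im t.2)
      - Phi R (im t.1) (im t.2) * ψ (t.1, 0) * ψ (0, t.2)‖ₑ ^ 2
    * ENNReal.ofReal (w t)

/-- The normalized process `Z_n(t₁, t₂) = √n (ψ(t₁, t₂) - Φ_{R⋆}(i t₁, i t₂) φ⋆(t₁) φ⋆(t₂))`. -/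
def Z {d : ℕ} (Rstar : PairLaw d) (Pstar : ProbabilityMeasure (E d)) (n : ℕ)
    (ψ : E d × E d → ℂ) (t : E d × E d) : ℂ :=
  (Real.sqrt n : ℂ) * (ψ t - Phi Rstar (im t.1) (im t.2)
    * charFun (Pstar : Measure (E d)) t.1 * charFun (Pstar : Measure (E d)) t.2)

/-- `V n = O_Pr(r n)` for nonnegative, possibly infinite, `V n`. No measurability is required:
`Pr` of a set that is not measurable is its outer probability. -/
def IsBigOInProb {Ω : Type*} [MeasurableSpace Ω] (Pr : Measure Ω) (V : ℕ → Ω → ℝ≥0∞)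
    (r : ℕ → ℝ) : Prop :=
  ∀ η : ℝ, 0 < η → ∃ C : ℝ, ∀ᶠ n in atTop,
    Pr {ω | ENNReal.ofReal (C * r n) < V n ω} ≤ ENNReal.ofReal η

/-- The distance `D` on the class `𝓡` metrizes weak convergence on `𝓡`. -/
def MetrizesWeakConvergence {d : ℕ} (𝓡 : Set (PairLaw d)) (D : MetricSpace 𝓡) : Prop :=
  D.toPseudoMetricSpace.toUniformSpace.toTopologicalSpace =
    @instTopologicalSpaceSubtype (PairLaw d) (fun R => R ∈ 𝓡) inferInstance

/-- The distance `D(R, A)` from a point to a set, for a given distance `D` on `𝓡`. -/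
def distToSet {d : ℕ} {𝓡 : Set (PairLaw d)} (D : MetricSpace 𝓡) (R : 𝓡) (A : Set 𝓡) : ℝ :=
  @Metric.infDist 𝓡 D.toPseudoMetricSpace R A

end HiddenTranslation

end

/-! Rate. The population criterion is the empirical one evaluated at the true characteristic
function of two observations (`crit_eq_empCrit`). Since `Phi` has modulus at most 1 at imaginary
points, the residual moves by at most `δ * (3 + δ)`, uniformly in the law, when the characteristic
function moves by `δ`. The true law is a candidate with zero residual at the true characteristic
function, so minimality gives `crit_le_of_uniform_close`, and `δ` is of order `1/√n`.

Consistency. By Fatou's lemma the criterion is lower semicontinuous, so on a compact class it is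
bounded below by a positive constant at distance at least `ε` from its zeros. It remains to see that
a zero `R` is the true law up to translation (`eqUpToTranslation_of_crit_eq_zero`). The noise
characteristic function is nonzero near the origin, so `Φ_{R⋆}(z₁, z₂) Φ_R(z₁, 0) Φ_R(0, z₂) =
Φ_R(z₁, z₂) Φ_{R⋆}(z₁, 0) Φ_{R⋆}(0, z₂)` holds for imaginary arguments near 0, hence everywhere by
analytic continuation. The dependency assumption allows one variable to be frozen where the joint
transform does not vanish; comparing orders of vanishing then shows that the marginal transforms
have the same zeros with multiplicity along every complex line through 0. Along the imaginary
directions they have growth order below 2, so, as in Hadamard's factorization, they differ by the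
exponential of a linear function (`eq_exp_mul_of_analyticOrderAt_eq`), whose slope is read off from
the means. Cancelling the marginals carries this factor over to the joint transforms: it is a
translation. -/

namespace HiddenTranslation

/-! ### Entire functions of order less than 2 with the same zeros. -/

section EntireFunctions

/-- Two entire functions with the same zeros, counted with multiplicity, differ by an entire
factor without zeros. -/
lemma exists_entire_quotient {f g : ℂ → ℂ} (hf : Differentiable ℂ f) (hg : Differentiable ℂ g)
    (hg0 : g 0 ≠ 0) (hord : ∀ z, analyticOrderAt f z = analyticOrderAt g z) :
    ∃ h : ℂ → ℂ, Differentiable ℂ h ∧ (∀ z, h z ≠ 0) ∧ ∀ z, f z = h z * g z := by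
  have haf (z : ℂ) : AnalyticAt ℂ f z := hf.analyticAt z
  have hag (z : ℂ) : AnalyticAt ℂ g z := hg.analyticAt z
  have hq : MeromorphicOn (f / g) Set.univ :=
    fun z _ => (haf z).meromorphicAt.div (hag z).meromorphicAt
  have hgtop (z : ℂ) : analyticOrderAt g z ≠ ⊤ := by
    intro htop
    rw [analyticOrderAt_eq_top] at htop
    have hagU : AnalyticOnNhd ℂ g Set.univ := fun z _ => hag z
    have := hagU.eq_of_eventuallyEq (g := 0) (fun _ _ => analyticAt_const) htop
    exact hg0 (by simp [this])
  have hq0 (z : ℂ) : meromorphicOrderAt (f / g) z = 0 := by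
    rw [meromorphicOrderAt_div (haf z).meromorphicAt (hag z).meromorphicAt,
      (haf z).meromorphicOrderAt_eq, (hag z).meromorphicOrderAt_eq, hord z]
    obtain ⟨k, hk⟩ := ENat.ne_top_iff_exists.1 (hgtop z)
    rw [← hk]
    simp only [ENat.map_natCast]
    exact LinearOrderedAddCommGroupWithTop.sub_self_eq_zero_of_ne_top (by simp)
  -- The pointwise quotient takes the junk value 0 at zeros of `g`; the normal form repairs these
  -- removable singularities.
  set h := toMeromorphicNFOn (f / g) Set.univ with hh
  have hnf (z : ℂ) : MeromorphicNFAt h z := meromorphicNFOn_toMeromorphicNFOn _ _ (Set.mem_univ z)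
  have heq (z : ℂ) : h =ᶠ[𝓝[≠] z] f / g := hq.toMeromorphicNFOn_eq_self_on_nhdsNE (Set.mem_univ z)
  have hh0 (z : ℂ) : meromorphicOrderAt h z = 0 := by
    rw [meromorphicOrderAt_congr (heq z), hq0]
  have hhan (z : ℂ) : AnalyticAt ℂ h z :=
    (hnf z).meromorphicOrderAt_nonneg_iff_analyticAt.1 (hh0 z).ge
  refine ⟨h, fun z => (hhan z).differentiableAt,
    fun z => (hnf z).meromorphicOrderAt_eq_zero_iff.1 (hh0 z), ?_⟩
  have hfU : AnalyticOnNhd ℂ f Set.univ := fun z _ => haf z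
  have hhgU : AnalyticOnNhd ℂ (fun z => h z * g z) Set.univ := fun z _ => (hhan z).mul (hag z)
  refine fun z => congrFun (hfU.eq_of_frequently_eq (z₀ := 0) hhgU (Eventually.frequently ?_)) z
  filter_upwards [heq 0, nhdsWithin_le_nhds (hg.continuous.continuousAt.eventually_ne hg0)]
    with z hz hgz
  rw [hz, Pi.div_apply, div_mul_cancel₀ _ hgz]

/-- An entire function without zeros that is `1` at the origin has an entire logarithm. -/
lemma exists_entire_log {h : ℂ → ℂ} (hh : Differentiable ℂ h) (h0 : ∀ z, h z ≠ 0) (h1 : h 0 = 1) :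
    ∃ L : ℂ → ℂ, Differentiable ℂ L ∧ L 0 = 0 ∧ ∀ z, h z = Complex.exp (L z) := by
  have hd : Differentiable ℂ (fun z => deriv h z / h z) :=
    (hh.contDiff (n := 2)).differentiable_deriv_two.div hh h0
  -- A primitive of `h' / h`: then `h * exp (-L)` has zero derivative.
  obtain ⟨L, hL0, hL⟩ := hd.isExactOn_univ.with_val_at 0 0
  have hL' (z : ℂ) : HasDerivAt L (deriv h z / h z) z := hL z (Set.mem_univ z)
  refine ⟨L, fun z => (hL' z).differentiableAt, hL0, fun z => ?_⟩
  have hder (z : ℂ) : HasDerivAt (fun z => h z * Complex.exp (-L z)) 0 z := by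
    refine HasDerivAt.congr_deriv ((hh z).hasDerivAt.mul (hL' z).neg.cexp) ?_
    have := h0 z
    rw [Pi.neg_apply]
    field_simp
    ring
  have hconst := is_const_of_deriv_eq_zero (fun z => (hder z).differentiableAt)
    (fun z => (hder z).deriv) z 0
  simp only [h1, hL0, neg_zero, Complex.exp_zero, mul_one] at hconst
  rw [Complex.exp_neg, mul_inv_eq_one₀ (Complex.exp_ne_zero _)] at hconst
  exact hconst

/-- By Jensen's formula the circle averages of `log ‖f‖` are nonnegative when `f 0 = 1`. -/
lemma circleAverage_log_norm_nonneg {f : ℂ → ℂ} (hf : Differentiable ℂ f) (hf0 : f 0 = 1) {R : ℝ}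
    (hR : 0 < R) : 0 ≤ Real.circleAverage (fun z => Real.log ‖f z‖) 0 R := by
  have han : AnalyticOnNhd ℂ f (Metric.closedBall 0 |R|) := fun z _ => hf.analyticAt z
  rw [AnalyticOnNhd.circleAverage_log_norm hR.ne' han (by simp [hf0]), hf0]
  simp only [norm_one, Real.log_one, add_zero]
  refine finsum_nonneg fun u => ?_
  by_cases hu : u ∈ Metric.closedBall (0 : ℂ) |R|
  -- At the centre the term vanishes by the conventions `0⁻¹ = 0` and `Real.log 0 = 0`; any other
  -- zero contributes its multiplicity times `log (R / ‖u‖) ≥ 0`.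
  · rcases eq_or_ne u 0 with rfl | hu0
    · simp
    · refine mul_nonneg ?_ (Real.log_nonneg ?_)
      · exact_mod_cast MeromorphicOn.AnalyticOnNhd.divisor_nonneg han u
      · have : 0 < ‖u‖ := norm_pos_iff.2 hu0
        rw [mem_closedBall_zero_iff, abs_of_pos hR] at hu
        rw [zero_sub, norm_neg, ← div_eq_mul_inv, one_le_div this]
        exact hu
  · rw [Function.locallyFinsuppWithin.apply_eq_zero_of_notMem _ hu]
    simp

lemma circleIntegrable_log_norm {f : ℂ → ℂ} (hf : Differentiable ℂ f) (R : ℝ) :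
    CircleIntegrable (fun z => Real.log ‖f z‖) 0 R :=
  MeromorphicOn.circleIntegrable_log_norm fun z _ => (hf.analyticAt z).meromorphicAt

/-- If `x ≤ K` and `0 ≤ K` then `|x| ≤ 2K - x`; averaging this for `x = log ‖f‖`, Jensen's formula
discards the last term. An upper bound on `f` thus also controls how small `f` is on average. -/
lemma circleAverage_abs_log_norm_le {f : ℂ → ℂ} (hf : Differentiable ℂ f) (hf0 : f 0 = 1)
    {R K : ℝ} (hR : 0 < R) (hK : 0 ≤ K) (hfK : ∀ z, ‖z‖ = R → ‖f z‖ ≤ Real.exp K) :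
    Real.circleAverage (fun z => |Real.log ‖f z‖|) 0 R ≤ 2 * K := by
  have hint := circleIntegrable_log_norm hf R
  have hle (z : ℂ) (hz : z ∈ Metric.sphere (0 : ℂ) |R|) :
      |Real.log ‖f z‖| ≤ 2 * K - Real.log ‖f z‖ := by
    rw [mem_sphere_zero_iff_norm, abs_of_pos hR] at hz
    have hlog : Real.log ‖f z‖ ≤ K := by
      rcases (norm_nonneg (f z)).eq_or_lt with h0 | h0
      · rw [← h0, Real.log_zero]; exact hK
      · exact (Real.log_le_iff_le_exp h0).2 (hfK z hz)
    exact abs_le.2 ⟨by linarith, by linarith⟩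
  have hc : CircleIntegrable (fun _ : ℂ => 2 * K) 0 R := circleIntegrable_const _ _ _
  calc Real.circleAverage (fun z => |Real.log ‖f z‖|) 0 R
      ≤ Real.circleAverage (fun z => 2 * K - Real.log ‖f z‖) 0 R :=
        Real.circleAverage_mono hint.abs (hc.sub hint) hle
    _ = 2 * K - Real.circleAverage (fun z => Real.log ‖f z‖) 0 R := by
        rw [Real.circleAverage_fun_sub hc hint, Real.circleAverage_const]
    _ ≤ 2 * K := by linarith [circleAverage_log_norm_nonneg hf hf0 hR]

/-- Poisson's formula bounds a harmonic function inside a disc by its mean modulus on the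
boundary. -/
lemma abs_re_le_circleAverage {L : ℂ → ℂ} (hL : Differentiable ℂ L) {R : ℝ} (hR : 0 < R) {w : ℂ}
    (hw : ‖w‖ ≤ R / 2) :
    |(L w).re| ≤ 4 * Real.circleAverage (fun z => |(L z).re|) 0 R := by
  have hharm : InnerProductSpace.HarmonicOnNhd (fun z => (L z).re) (Metric.closedBall 0 R) :=
    fun z _ => (hL.analyticAt z).harmonicAt_re
  have hcont : Continuous (fun z => (L z).re) := Complex.continuous_re.comp hL.continuous
  have hwR : w ∈ Metric.ball (0 : ℂ) R := by
    rw [mem_ball_zero_iff]; linarith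
  have hci : CircleIntegrable (fun z => 4 * |(L z).re|) 0 R :=
    (continuous_const.mul hcont.abs).continuousOn.circleIntegrable'
  have hsphere (z : ℂ) (hz : z ∈ Metric.sphere (0 : ℂ) |R|) : ‖z‖ = R := by
    simpa [abs_of_pos hR] using hz
  have hne (z : ℂ) (hz : z ∈ Metric.sphere (0 : ℂ) |R|) : R / 2 ≤ ‖z - w‖ := by
    have := norm_sub_norm_le z w
    rw [hsphere z hz] at this
    linarith
  rw [← hharm.circleAverage_poissonKernel_smul hwR]
  refine Real.abs_circleAverage_le_circleAverage_abs.trans ?_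
  have h4 : 4 * Real.circleAverage (fun z => |(L z).re|) 0 R
      = Real.circleAverage (fun z => 4 * |(L z).re|) 0 R :=
    (Real.circleAverage_fun_smul (a := (4 : ℝ)) (f := fun z => |(L z).re|)).symm
  rw [h4]
  refine Real.circleAverage_mono ?_ hci ?_
  · refine ContinuousOn.circleIntegrable' ?_
    refine ContinuousOn.abs (ContinuousOn.smul ?_ hcont.continuousOn)
    unfold poissonKernel
    refine ContinuousOn.div (by fun_prop) (by fun_prop) fun z hz => ?_
    have := hne z hz
    have : 0 < ‖z - w‖ := by linarith
    simp only [sub_zero]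
    positivity
  · intro z hz
    have hzw := hne z hz
    have hzw0 : 0 < ‖z - w‖ := by linarith
    -- The kernel `(R² - ‖w‖²) / ‖z - w‖²` is at most `R² / (R/2)² = 4`.
    change |poissonKernel 0 w z * (L z).re| ≤ 4 * |(L z).re|
    rw [abs_mul]
    refine mul_le_mul_of_nonneg_right ?_ (abs_nonneg _)
    rw [poissonKernel]
    simp only [sub_zero]
    rw [hsphere z hz, abs_of_nonneg (div_nonneg (by nlinarith [norm_nonneg w]) (by positivity)),
      div_le_iff₀ (by positivity)]
    nlinarith [norm_nonneg w]

/-- An entire function whose modulus on the discs of radius `R` is `O(R ^ ρ)` with `ρ < 2` is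
affine. -/
lemma eq_deriv_mul_of_growth {L : ℂ → ℂ} (hL : Differentiable ℂ L) (hL0 : L 0 = 0) {C ρ : ℝ}
    (hρ : ρ < 2) (hC : ∀ R : ℝ, 1 ≤ R → ∀ z, ‖z‖ ≤ R / 4 → ‖L z‖ ≤ C * R ^ ρ) (z : ℂ) :
    L z = deriv L 0 * z := by
  have hL2 : ContDiff ℂ 2 L := hL.contDiff
  have h2 (c : ℂ) : deriv (deriv L) c = 0 := by
    -- Cauchy's estimate on the circle of radius `R/8` about `c`, which lies in the disc of radius
    -- `R/4` once `R ≥ 8‖c‖`; the constant is `2! * 8² = 128`.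
    have hbd : ∀ᶠ R : ℝ in atTop, ‖iteratedDeriv 2 L c‖ ≤ 128 * C * R ^ (-(2 - ρ)) := by
      filter_upwards [eventually_ge_atTop (8 * ‖c‖ + 1)] with R hR
      have hR0 : 1 ≤ R := by linarith [norm_nonneg c]
      have := Complex.norm_iteratedDeriv_le_of_forall_mem_sphere_norm_le (F := ℂ) (f := L) (c := c)
        (R := R / 8) (C := C * R ^ ρ) 2 (by linarith) hL.diffContOnCl (fun z hz => by
          refine hC R hR0 z ?_
          have hz' : ‖z - c‖ = R / 8 := by simpa [dist_eq_norm] using hz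
          have := norm_sub_norm_le z c
          linarith)
      refine this.trans (le_of_eq ?_)
      have h1 : R ^ (-(2 - ρ)) = R ^ ρ / R ^ 2 := by
        rw [show -(2 - ρ) = ρ - 2 by ring, Real.rpow_sub (by linarith)]
        norm_num
      rw [h1]
      have : R ≠ 0 := by linarith
      simp only [Nat.factorial]
      field_simp
      push_cast
      ring
    have hlim : Tendsto (fun R : ℝ => 128 * C * R ^ (-(2 - ρ))) atTop (𝓝 (128 * C * 0)) :=
      (tendsto_rpow_neg_atTop (by linarith)).const_mul _
    rw [mul_zero] at hlim
    have := ge_of_tendsto hlim hbd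
    rw [iteratedDeriv_succ, iteratedDeriv_one] at this
    simpa using this
  have hd : Differentiable ℂ (deriv L) := hL2.differentiable_deriv_two
  have hder (z : ℂ) : HasDerivAt (fun z => L z - deriv L 0 * z) 0 z := by
    have h1 := (hL z).hasDerivAt.sub ((hasDerivAt_id z).const_mul (deriv L 0))
    rw [is_const_of_deriv_eq_zero hd h2 z 0, mul_one, sub_self] at h1
    exact h1
  have := is_const_of_deriv_eq_zero (fun z => (hder z).differentiableAt)
    (fun z => (hder z).deriv) z 0
  simp only [hL0, mul_zero, sub_zero] at this
  exact sub_eq_zero.1 this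

/-- Two entire functions of order less than `2`, normalized at the origin and with the same zeros
counted with multiplicity, differ by an exponential factor. -/
theorem eq_exp_mul_of_analyticOrderAt_eq {f g : ℂ → ℂ} (hf : Differentiable ℂ f)
    (hg : Differentiable ℂ g) (hf0 : f 0 = 1) (hg0 : g 0 = 1)
    (hord : ∀ z, analyticOrderAt f z = analyticOrderAt g z) {K ρ : ℝ} (hρ : ρ < 2)
    (hfK : ∀ R : ℝ, 1 ≤ R → ∀ z, ‖z‖ = R → ‖f z‖ ≤ Real.exp (K * R ^ ρ))
    (hgK : ∀ R : ℝ, 1 ≤ R → ∀ z, ‖z‖ = R → ‖g z‖ ≤ Real.exp (K * R ^ ρ)) (hK : 0 < K) (z : ℂ) :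
    f z = Complex.exp ((deriv f 0 - deriv g 0) * z) * g z := by
  obtain ⟨h, hh, hh0, hfh⟩ := exists_entire_quotient hf hg (by simp [hg0]) hord
  have hh1 : h 0 = 1 := by simpa [hf0, hg0] using (hfh 0).symm
  obtain ⟨L, hL, hL0, hhL⟩ := exists_entire_log hh hh0 hh1
  have hlog (z : ℂ) (hz : g z ≠ 0) : (L z).re = Real.log ‖f z‖ - Real.log ‖g z‖ := by
    rw [hfh z, norm_mul, Real.log_mul (by simpa using hh0 z) (by simpa using hz), hhL z,
      Complex.norm_exp, Real.log_exp]
    ring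
  -- `16 = 4 * (2 + 2)`: the Poisson factor times the two Jensen bounds. The formula for `Re L`
  -- fails only at zeros of `g`, which circle averages ignore.
  have hre (R : ℝ) (hR : 1 ≤ R) (w : ℂ) (hw : ‖w‖ ≤ R / 2) : |(L w).re| ≤ 16 * (K * R ^ ρ) := by
    have hR0 : 0 < R := by linarith
    have hKR : 0 ≤ K * R ^ ρ := by positivity
    have hcd : (fun z => |(L z).re|) =ᶠ[codiscreteWithin (Metric.sphere (0 : ℂ) |R|)]
        fun z => |Real.log ‖f z‖ - Real.log ‖g z‖| := by
      have hgan : AnalyticOnNhd ℂ g Set.univ := fun z _ => hg.analyticAt z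
      have hcd := hgan.preimage_zero_mem_codiscrete (x := 0) (by simp [hg0])
      filter_upwards [codiscreteWithin_mono (Set.subset_univ _) hcd] with z hz
      rw [hlog z (by simpa using hz)]
    have h1 := abs_re_le_circleAverage hL hR0 hw
    rw [Real.circleAverage_congr_codiscreteWithin hcd hR0.ne'] at h1
    have hif := circleIntegrable_log_norm hf R
    have hig := circleIntegrable_log_norm hg R
    have h2 : Real.circleAverage (fun z => |Real.log ‖f z‖ - Real.log ‖g z‖|) 0 R
        ≤ Real.circleAverage (fun z => |Real.log ‖f z‖| + |Real.log ‖g z‖|) 0 R :=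
      Real.circleAverage_mono (hif.sub hig).abs (hif.abs.add hig.abs) fun z _ => abs_sub _ _
    have h2' : Real.circleAverage (fun z => |Real.log ‖f z‖| + |Real.log ‖g z‖|) 0 R
        = Real.circleAverage (fun z => |Real.log ‖f z‖|) 0 R
          + Real.circleAverage (fun z => |Real.log ‖g z‖|) 0 R :=
      Real.circleAverage_fun_add hif.abs hig.abs
    have h3 := circleAverage_abs_log_norm_le hf hf0 hR0 hKR (hfK R hR)
    have h4 := circleAverage_abs_log_norm_le hg hg0 hR0 hKR (hgK R hR)
    linarith
  -- Borel–Carathéodory on radius `R/2`: for `‖z‖ ≤ R/4` the ratio `‖z‖ / (R/2 - ‖z‖)` is at most 1,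
  -- which leaves twice the bound on the real part.
  have hgrow (R : ℝ) (hR : 1 ≤ R) (z : ℂ) (hz : ‖z‖ ≤ R / 4) : ‖L z‖ ≤ (32 * K) * R ^ ρ := by
    have hM : 0 < 16 * (K * R ^ ρ) := by
      have : 0 < R := by linarith
      positivity
    have hzR : ‖z‖ < R / 2 := by linarith
    have := Complex.borelCaratheodory_zero hM (hL.differentiableOn (s := Metric.ball 0 (R / 2)))
      (fun w hw => (le_abs_self _).trans (hre R hR w (by
        rw [mem_ball_zero_iff] at hw; exact hw.le))) (by linarith) (mem_ball_zero_iff.2 hzR) hL0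
    refine this.trans ?_
    rw [div_le_iff₀ (by linarith)]
    nlinarith [norm_nonneg z]
  have hLlin := eq_deriv_mul_of_growth hL hL0 hρ hgrow
  have hfexp (z : ℂ) : f z = Complex.exp (deriv L 0 * z) * g z := by
    rw [hfh z, hhL z, hLlin z]
  have hderiv : deriv f 0 = deriv L 0 + deriv g 0 := by
    have h1 : HasDerivAt (fun z => Complex.exp (deriv L 0 * z) * g z)
        (deriv L 0 + deriv g 0) 0 := by
      refine HasDerivAt.congr_deriv
        ((((hasDerivAt_id (0 : ℂ)).const_mul (deriv L 0)).cexp).mul (hg 0).hasDerivAt) ?_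
      simp [hg0]
    rw [← h1.deriv]
    exact congrArg (fun F => deriv F 0) (funext hfexp)
  rw [hderiv, add_sub_cancel_right]
  exact hfexp z

end EntireFunctions

end HiddenTranslation

noncomputable section

namespace HiddenTranslation

/-! ### Analyticity, growth and first derivative of the Laplace transform. -/

section LaplaceTransform

variable {d : ℕ}

/-- The exponent `z₁ᵀ x₁ + z₂ᵀ x₂` of the Laplace transform. -/
def linForm (z₁ z₂ : Fin d → ℂ) (x : E d × E d) : ℂ :=
  ∑ j, z₁ j * (x.1 j : ℂ) + ∑ j, z₂ j * (x.2 j : ℂ)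

lemma Phi_eq (R : PairLaw d) (z₁ z₂ : Fin d → ℂ) :
    Phi R z₁ z₂ = ∫ x, Complex.exp (linForm z₁ z₂ x) ∂(R : Measure (E d × E d)) := rfl

lemma continuous_linForm (z₁ z₂ : Fin d → ℂ) : Continuous (linForm z₁ z₂) := by
  unfold linForm
  fun_prop

lemma linForm_add_smul (p₁ p₂ q₁ q₂ : Fin d → ℂ) (s : ℂ) (x : E d × E d) :
    linForm (p₁ + s • q₁) (p₂ + s • q₂) x = linForm p₁ p₂ x + s * linForm q₁ q₂ x := by
  simp only [linForm, Pi.add_apply, Pi.smul_apply, smul_eq_mul, add_mul, Finset.sum_add_distrib,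
    mul_add, Finset.mul_sum, mul_assoc]
  ring

lemma linForm_im (t₁ t₂ : E d) (x : E d × E d) :
    linForm (im t₁) (im t₂) x = Complex.I * ((inner ℝ t₁ x.1 + inner ℝ t₂ x.2 : ℝ) : ℂ) := by
  simp only [linForm, im, PiLp.inner_apply, RCLike.inner_apply, conj_trivial]
  push_cast
  rw [mul_add, Finset.mul_sum, Finset.mul_sum]
  congr 1 <;> exact Finset.sum_congr rfl fun j _ => by ring

lemma re_linForm (z₁ z₂ : Fin d → ℂ) (x : E d × E d) :
    (linForm z₁ z₂ x).re = inner ℝ (WithLp.toLp 2 fun j => (z₁ j).re : E d) x.1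
      + inner ℝ (WithLp.toLp 2 fun j => (z₂ j).re : E d) x.2 := by
  simp [linForm, PiLp.inner_apply, mul_comm]

lemma im_zero : im (0 : E d) = 0 := by
  ext j
  simp [im]

lemma im_add (s t : E d) : im (s + t) = im s + im t := by
  ext j
  simp [im, mul_add]

lemma im_smul (r : ℝ) (t : E d) : im (r • t) = (r : ℂ) • im t := by
  ext j
  simp only [im, PiLp.smul_apply, smul_eq_mul, Pi.smul_apply]
  push_cast
  ring

lemma Phi_zero_zero (R : PairLaw d) : Phi R 0 0 = 1 := by
  simp [Phi]

lemma norm_exp_linForm_im (t₁ t₂ : E d) (x : E d × E d) :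
    ‖Complex.exp (linForm (im t₁) (im t₂) x)‖ = 1 := by
  rw [linForm_im, mul_comm, Complex.norm_exp_ofReal_mul_I]

lemma norm_Phi_im_le_one (R : PairLaw d) (t₁ t₂ : E d) : ‖Phi R (im t₁) (im t₂)‖ ≤ 1 := by
  rw [Phi_eq]
  refine (norm_integral_le_integral_norm _).trans ?_
  simp [norm_exp_linForm_im]

lemma continuous_Phi_im (R : PairLaw d) :
    Continuous fun t : E d × E d => Phi R (im t.1) (im t.2) := by
  simp only [Phi_eq]
  refine continuous_of_dominated (bound := fun _ => 1) ?_ ?_ (integrable_const _) ?_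
  · exact fun t => (Complex.continuous_exp.comp (continuous_linForm _ _)).aestronglyMeasurable
  · exact fun t => Eventually.of_forall fun x => (norm_exp_linForm_im _ _ _).le
  · refine Eventually.of_forall fun x => ?_
    simp only [linForm_im]
    fun_prop

lemma continuous_Phi_im_law (t₁ t₂ : E d) :
    Continuous fun R : PairLaw d => Phi R (im t₁) (im t₂) := by
  rw [continuous_iff_continuousAt]
  intro R
  have h := (ProbabilityMeasure.tendsto_iff_forall_integral_rclike_tendsto ℂ).1
    (tendsto_id (x := 𝓝 R))
  exact h (BoundedContinuousFunction.ofNormedAddCommGroup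
    (fun x => Complex.exp (linForm (im t₁) (im t₂) x))
    (Complex.continuous_exp.comp (continuous_linForm _ _)) 1
    fun x => (norm_exp_linForm_im _ _ _).le)

lemma LightTail.integrable_exp {ρ : ℝ} {μ : Measure (E d)} (hμ : LightTail ρ μ) (u : E d) :
    Integrable (fun x => Real.exp (inner ℝ u x)) μ := by
  obtain ⟨A, B, -, -, h⟩ := hμ
  have hc : Continuous fun x : E d => Real.exp (inner ℝ u x) := by fun_prop
  refine ⟨hc.aestronglyMeasurable, ?_⟩
  rw [hasFiniteIntegral_iff_ofReal (Eventually.of_forall fun x => (Real.exp_pos _).le)]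
  exact (h u).trans_lt ENNReal.ofReal_lt_top

variable {ρ : ℝ} {R R' : PairLaw d}

/-- Tail bounds on the marginals suffice, because `exp (a + b) ≤ exp (2a) + exp (2b)`. -/
lemma integrable_exp_linForm (h₁ : LightTail ρ (R : Measure (E d × E d)).fst)
    (h₂ : LightTail ρ (R : Measure (E d × E d)).snd) (z₁ z₂ : Fin d → ℂ) :
    Integrable (fun x => Complex.exp (linForm z₁ z₂ x)) (R : Measure (E d × E d)) := by
  set a : E d := WithLp.toLp 2 fun j => (z₁ j).re
  set b : E d := WithLp.toLp 2 fun j => (z₂ j).re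
  have ha : Integrable (fun x : E d × E d => Real.exp (inner ℝ ((2 : ℝ) • a) x.1))
      (R : Measure (E d × E d)) :=
    Integrable.comp_measurable (μ := (R : Measure (E d × E d))) (f := Prod.fst)
      (h₁.integrable_exp _) measurable_fst
  have hb : Integrable (fun x : E d × E d => Real.exp (inner ℝ ((2 : ℝ) • b) x.2))
      (R : Measure (E d × E d)) :=
    Integrable.comp_measurable (μ := (R : Measure (E d × E d))) (f := Prod.snd)
      (h₂.integrable_exp _) measurable_snd
  refine (ha.add hb).mono'
    (Complex.continuous_exp.comp (continuous_linForm _ _)).aestronglyMeasurable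
    (Eventually.of_forall fun x => ?_)
  rw [Complex.norm_exp, re_linForm]
  simp only [Pi.add_apply, inner_smul_left, conj_trivial]
  rw [Real.exp_add, two_mul, two_mul, Real.exp_add, Real.exp_add]
  nlinarith [sq_nonneg (Real.exp (inner ℝ a x.1) - Real.exp (inner ℝ b x.2)),
    Real.exp_pos (inner ℝ a x.1), Real.exp_pos (inner ℝ b x.2)]

/-- The Laplace transform is complex differentiable along complex lines. -/
lemma hasDerivAt_Phi (h₁ : LightTail ρ (R : Measure (E d × E d)).fst)
    (h₂ : LightTail ρ (R : Measure (E d × E d)).snd) (p₁ p₂ q₁ q₂ : Fin d → ℂ) (s₀ : ℂ) :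
    Integrable (fun x => linForm q₁ q₂ x
        * Complex.exp (linForm (p₁ + s₀ • q₁) (p₂ + s₀ • q₂) x)) (R : Measure (E d × E d)) ∧
      HasDerivAt (fun s : ℂ => Phi R (p₁ + s • q₁) (p₂ + s • q₂))
        (∫ x, linForm q₁ q₂ x * Complex.exp (linForm (p₁ + s₀ • q₁) (p₂ + s₀ • q₂) x)
          ∂(R : Measure (E d × E d))) s₀ := by
  have hint (s : ℂ) := integrable_exp_linForm h₁ h₂ (p₁ + s • q₁) (p₂ + s • q₂)
  have hcont (s : ℂ) := continuous_linForm (p₁ + s • q₁) (p₂ + s • q₂)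
  have hq := continuous_linForm q₁ q₂
  simp only [Phi_eq]
  -- With `w = linForm q₁ q₂ x` and `‖s - s₀‖ < 1`, the factor `‖w‖ ≤ exp ‖w‖` and the shift of `s`
  -- cost at most `exp (2‖w‖) ≤ exp (2|Re w| + 2|Im w|)`. For each choice of signs this is the
  -- growth at one of the corners `s₀ ± 2 ± 2i`, so the sum over the four corners dominates.
  let N : ℂ → E d × E d → ℝ :=
    fun s x => ‖Complex.exp (linForm (p₁ + s • q₁) (p₂ + s • q₂) x)‖
  refine hasDerivAt_integral_of_dominated_loc_of_deriv_le
    (F' := fun s x => linForm q₁ q₂ x * Complex.exp (linForm (p₁ + s • q₁) (p₂ + s • q₂) x))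
    (bound := fun x => N (s₀ + (2 - 2 * Complex.I)) x + N (s₀ + (2 + 2 * Complex.I)) x
      + N (s₀ + (-2 - 2 * Complex.I)) x + N (s₀ + (-2 + 2 * Complex.I)) x)
    (Metric.ball_mem_nhds s₀ one_pos) ?_ (hint s₀) ?_ ?_ ?_ ?_
  · exact Eventually.of_forall fun s => (hint s).aestronglyMeasurable
  · exact (hq.mul (Complex.continuous_exp.comp (hcont s₀))).aestronglyMeasurable
  · refine Eventually.of_forall fun x s hs => ?_
    have hNv (s : ℂ) : N s x = Real.exp ((linForm p₁ p₂ x).re + (s * linForm q₁ q₂ x).re) := by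
      simp only [N, Complex.norm_exp, linForm_add_smul, Complex.add_re]
    have hns : ‖s - s₀‖ < 1 := by simpa [dist_eq_norm] using hs
    rw [norm_mul]
    change ‖linForm q₁ q₂ x‖ * N s x ≤ _
    simp only [hNv]
    set w := linForm q₁ q₂ x
    set P := (linForm p₁ p₂ x).re
    have h3 : (s * w).re ≤ (s₀ * w).re + ‖w‖ := by
      have h4 : s * w = s₀ * w + (s - s₀) * w := by ring
      rw [h4, Complex.add_re]
      gcongr
      refine (Complex.re_le_norm _).trans ?_
      rw [norm_mul]
      nlinarith [norm_nonneg w]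
    have hw : ‖w‖ ≤ |w.re| + |w.im| := Complex.norm_le_abs_re_add_abs_im w
    have hwe : ‖w‖ ≤ Real.exp ‖w‖ := by linarith [Real.add_one_le_exp ‖w‖]
    have hle : ‖w‖ * Real.exp (P + (s * w).re)
        ≤ Real.exp (P + (s₀ * w).re + (2 * |w.re| + 2 * |w.im|)) := by
      calc ‖w‖ * Real.exp (P + (s * w).re)
          ≤ Real.exp ‖w‖ * Real.exp (P + (s * w).re) := by gcongr
        _ = Real.exp (‖w‖ + (P + (s * w).re)) := (Real.exp_add _ _).symm
        _ ≤ _ := Real.exp_le_exp.2 (by linarith)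
    refine hle.trans ?_
    have e1 : ((s₀ + (2 - 2 * Complex.I)) * w).re = (s₀ * w).re + (2 * w.re + 2 * w.im) := by
      simp [add_mul, sub_mul]
    have e2 : ((s₀ + (2 + 2 * Complex.I)) * w).re = (s₀ * w).re + (2 * w.re - 2 * w.im) := by
      simp [add_mul]
      ring
    have e3 : ((s₀ + (-2 - 2 * Complex.I)) * w).re = (s₀ * w).re + (-2 * w.re + 2 * w.im) := by
      simp [add_mul, sub_mul]
    have e4 : ((s₀ + (-2 + 2 * Complex.I)) * w).re = (s₀ * w).re + (-2 * w.re - 2 * w.im) := by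
      simp [add_mul]
      ring
    rw [e1, e2, e3, e4]
    have h1 := Real.exp_pos (P + ((s₀ * w).re + (2 * w.re + 2 * w.im)))
    have h2 := Real.exp_pos (P + ((s₀ * w).re + (2 * w.re - 2 * w.im)))
    have h3 := Real.exp_pos (P + ((s₀ * w).re + (-2 * w.re + 2 * w.im)))
    have h4 := Real.exp_pos (P + ((s₀ * w).re + (-2 * w.re - 2 * w.im)))
    rcases abs_choice w.re with hr | hr <;> rcases abs_choice w.im with hi | hi <;> rw [hr, hi]
    · rw [add_assoc P]
      linarith
    · rw [show P + (s₀ * w).re + (2 * w.re + 2 * -w.im)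
        = P + ((s₀ * w).re + (2 * w.re - 2 * w.im)) by ring]
      linarith
    · rw [show P + (s₀ * w).re + (2 * -w.re + 2 * w.im)
        = P + ((s₀ * w).re + (-2 * w.re + 2 * w.im)) by ring]
      linarith
    · rw [show P + (s₀ * w).re + (2 * -w.re + 2 * -w.im)
        = P + ((s₀ * w).re + (-2 * w.re - 2 * w.im)) by ring]
      linarith
  · exact (((hint _).norm.add (hint _).norm).add (hint _).norm).add (hint _).norm
  · refine Eventually.of_forall fun x s _ => ?_
    simp only [linForm_add_smul]
    have h := (((hasDerivAt_id s).mul_const (linForm q₁ q₂ x)).const_add (linForm p₁ p₂ x)).cexp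
    refine h.congr_deriv ?_
    simp only [id]
    ring

lemma differentiable_Phi (h₁ : LightTail ρ (R : Measure (E d × E d)).fst)
    (h₂ : LightTail ρ (R : Measure (E d × E d)).snd) (p₁ p₂ q₁ q₂ : Fin d → ℂ) :
    Differentiable ℂ fun s : ℂ => Phi R (p₁ + s • q₁) (p₂ + s • q₂) :=
  fun s => (hasDerivAt_Phi h₁ h₂ p₁ p₂ q₁ q₂ s).2.differentiableAt

lemma differentiable_Phi_left (h₁ : LightTail ρ (R : Measure (E d × E d)).fst)
    (h₂ : LightTail ρ (R : Measure (E d × E d)).snd) (q₁ z₂ : Fin d → ℂ) :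
    Differentiable ℂ fun s : ℂ => Phi R (s • q₁) z₂ := by
  simpa using differentiable_Phi h₁ h₂ 0 z₂ q₁ 0

lemma differentiable_Phi_right (h₁ : LightTail ρ (R : Measure (E d × E d)).fst)
    (h₂ : LightTail ρ (R : Measure (E d × E d)).snd) (z₁ q₂ : Fin d → ℂ) :
    Differentiable ℂ fun s : ℂ => Phi R z₁ (s • q₂) := by
  simpa using differentiable_Phi h₁ h₂ z₁ 0 0 q₂

lemma Phi_left_eq (R : PairLaw d) (z : Fin d → ℂ) :
    Phi R z 0 = ∫ x : E d, Complex.exp (∑ j, z j * (x j : ℂ))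
      ∂(R : Measure (E d × E d)).fst := by
  have hc : Continuous fun x : E d => Complex.exp (∑ j, z j * (x j : ℂ)) := by fun_prop
  rw [Measure.fst, integral_map measurable_fst.aemeasurable hc.aestronglyMeasurable]
  simp [Phi]

lemma Phi_right_eq (R : PairLaw d) (z : Fin d → ℂ) :
    Phi R 0 z = ∫ x : E d, Complex.exp (∑ j, z j * (x j : ℂ))
      ∂(R : Measure (E d × E d)).snd := by
  have hc : Continuous fun x : E d => Complex.exp (∑ j, z j * (x j : ℂ)) := by fun_prop
  rw [Measure.snd, integral_map measurable_snd.aemeasurable hc.aestronglyMeasurable]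
  simp [Phi]

lemma Phi_left_eq_right (hR : (R : Measure (E d × E d)).fst = (R : Measure (E d × E d)).snd)
    (z : Fin d → ℂ) : Phi R z 0 = Phi R 0 z := by
  rw [Phi_left_eq, Phi_right_eq, hR]

/-- Along the complex line spanned by `i t` the Laplace transform of the first marginal grows at
most like `exp (K r ^ ρ)`. -/
lemma exists_norm_Phi_le (hρ : 0 < ρ) (h₁ : LightTail ρ (R : Measure (E d × E d)).fst) (t : E d) :
    ∃ K₀ : ℝ, ∀ K, K₀ ≤ K → ∀ r : ℝ, 1 ≤ r → ∀ s : ℂ, ‖s‖ = r →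
      ‖Phi R (s • im t) 0‖ ≤ Real.exp (K * r ^ ρ) := by
  obtain ⟨A, B, hA, hB, h⟩ := id h₁
  -- The prefactor `A = exp (log A)` is absorbed in the exponent because `r ^ ρ ≥ 1`.
  refine ⟨|Real.log A| + B * ‖t‖ ^ ρ, fun K hK r hr s hs => ?_⟩
  set u : E d := (-s.im) • t
  have hnorm : ‖Phi R (s • im t) 0‖ ≤ ∫ x, Real.exp (inner ℝ u x)
      ∂(R : Measure (E d × E d)).fst := by
    rw [Phi_left_eq]
    refine (norm_integral_le_integral_norm _).trans (le_of_eq ?_)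
    congr 1 with x
    rw [Complex.norm_exp]
    congr 1
    simp [u, im, PiLp.inner_apply, mul_comm, mul_assoc]
  have hint := h₁.integrable_exp u
  have hle : ∫ x, Real.exp (inner ℝ u x) ∂(R : Measure (E d × E d)).fst
      ≤ A * Real.exp (B * ‖u‖ ^ ρ) := by
    rw [integral_eq_lintegral_of_nonneg_ae (Eventually.of_forall fun x => (Real.exp_pos _).le)
      hint.aestronglyMeasurable]
    exact ENNReal.toReal_le_of_le_ofReal (by positivity) (h u)
  refine (hnorm.trans hle).trans ?_
  have hu : ‖u‖ ≤ r * ‖t‖ := by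
    rw [norm_smul, norm_neg, Real.norm_eq_abs, ← hs]
    gcongr
    exact Complex.abs_im_le_norm s
  have hupow : ‖u‖ ^ ρ ≤ r ^ ρ * ‖t‖ ^ ρ := by
    rw [← Real.mul_rpow (by linarith) (norm_nonneg t)]
    gcongr
  have hrρ : 1 ≤ r ^ ρ := Real.one_le_rpow hr hρ.le
  nth_rw 1 [← Real.exp_log hA]
  rw [← Real.exp_add]
  refine Real.exp_le_exp.2 ?_
  have h5 : Real.log A ≤ |Real.log A| * r ^ ρ :=
    (le_abs_self _).trans (le_mul_of_one_le_right (abs_nonneg _) hrρ)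
  have h6 : B * ‖u‖ ^ ρ ≤ B * (r ^ ρ * ‖t‖ ^ ρ) := by gcongr
  have h7 : (|Real.log A| + B * ‖t‖ ^ ρ) * r ^ ρ ≤ K * r ^ ρ := by gcongr
  linarith [h5, h6, h7]

/-- The mean of the first marginal. -/
def mean (R : PairLaw d) : E d :=
  WithLp.toLp 2 fun j => ∫ x, x.1 j ∂(R : Measure (E d × E d))

/-- The slope is linear in `t`, so the exponential factors found on separate lines come from a
single translation vector. -/
lemma deriv_Phi_left (h₁ : LightTail ρ (R : Measure (E d × E d)).fst)
    (h₂ : LightTail ρ (R : Measure (E d × E d)).snd) (t : E d) :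
    deriv (fun s : ℂ => Phi R (s • im t) 0) 0 = Complex.I * ((inner ℝ t (mean R) : ℝ) : ℂ) := by
  have hcoord (j : Fin d) : Integrable (fun x : E d × E d => x.1 j) (R : Measure (E d × E d)) := by
    -- The derivative integrand in direction `e_j` at the origin is the coordinate itself.
    have h := (hasDerivAt_Phi h₁ h₂ 0 0 (Pi.single j 1) 0 0).1.re
    refine h.congr (Eventually.of_forall fun x => ?_)
    simp [linForm, Pi.single_apply]
  have h := (hasDerivAt_Phi h₁ h₂ 0 0 (im t) 0 0).2
  simp only [zero_add, smul_zero, zero_smul] at h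
  rw [h.deriv]
  have hx (x : E d × E d) : linForm (im t) 0 x * Complex.exp (linForm 0 0 x)
      = Complex.I * ((inner ℝ t x.1 : ℝ) : ℂ) := by
    have h0 := linForm_im t 0 x
    rw [im_zero] at h0
    rw [h0]
    simp [linForm]
  simp only [hx]
  rw [integral_const_mul, integral_complex_ofReal]
  congr 2
  simp only [PiLp.inner_apply, RCLike.inner_apply, conj_trivial]
  rw [integral_finsetSum _ fun j _ => (hcoord j).mul_const _]
  simp only [integral_mul_const, mean]

end LaplaceTransform

end HiddenTranslation

end

noncomputable section

namespace HiddenTranslation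

/-! ### Laws with vanishing criterion are translates of the true law. -/

section Identification

variable {d : ℕ} {ρ : ℝ} {R R' : PairLaw d}

/-- An entire function that vanishes at the real points near the origin vanishes. -/
lemma eq_zero_of_eventually_real {f : ℂ → ℂ} (hf : Differentiable ℂ f)
    (h : ∀ᶠ r : ℝ in 𝓝 0, f r = 0) (z : ℂ) : f z = 0 := by
  have han : AnalyticOnNhd ℂ f Set.univ := fun z _ => hf.analyticAt z
  have htend : Tendsto (fun r : ℝ => (r : ℂ)) (𝓝[≠] 0) (𝓝[≠] 0) := by
    refine tendsto_nhdsWithin_iff.2 ⟨?_, ?_⟩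
    · exact (Complex.continuous_ofReal.tendsto' 0 0 (by simp)).mono_left nhdsWithin_le_nhds
    · filter_upwards [self_mem_nhdsWithin] with r hr
      simpa using hr
  have hfreq : ∃ᶠ z in 𝓝[≠] (0 : ℂ), f z = 0 :=
    htend.frequently (h.filter_mono nhdsWithin_le_nhds).frequently
  exact congrFun (han.eq_of_frequently_eq (g := 0) (fun _ _ => analyticAt_const) hfreq) z

/-- Entire functions form an integral domain. -/
lemma exists_ne_zero_of_entire {u v : ℂ → ℂ} (hu : Differentiable ℂ u) (hv : Differentiable ℂ v)
    {a b : ℂ} (ha : u a ≠ 0) (hb : v b ≠ 0) : ∃ s, u s ≠ 0 ∧ v s ≠ 0 := by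
  by_contra! hcon
  have hmul (z : ℂ) : u z * v z = 0 := by
    rcases eq_or_ne (u z) 0 with h | h
    · simp [h]
    · simp [hcon z h]
  rcases AnalyticOnNhd.eq_zero_or_eq_zero_of_mul_eq_zero (U := Set.univ)
    (fun z _ => hu.analyticAt z) (fun z _ => hv.analyticAt z) (fun z _ => hmul z)
    isPreconnected_univ with h | h
  · exact ha (h a trivial)
  · exact hb (h b trivial)

/-- The identity between the Laplace transforms of two laws that the criterion enforces. -/
def PhiIdentity (R R' : PairLaw d) : Prop :=
  ∀ z₁ z₂ : Fin d → ℂ, Phi R' z₁ z₂ * (Phi R z₁ 0 * Phi R 0 z₂)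
    = Phi R z₁ z₂ * (Phi R' z₁ 0 * Phi R' 0 z₂)

lemma PhiIdentity.symm (h : PhiIdentity R R') : PhiIdentity R' R := fun z₁ z₂ => (h z₁ z₂).symm

/-- Analytic continuation of the identity from the imaginary points near the origin. -/
lemma phiIdentity_of_eventually (h₁ : LightTail ρ (R : Measure (E d × E d)).fst)
    (h₂ : LightTail ρ (R : Measure (E d × E d)).snd)
    (h₁' : LightTail ρ (R' : Measure (E d × E d)).fst)
    (h₂' : LightTail ρ (R' : Measure (E d × E d)).snd)
    (h : ∀ᶠ t : E d × E d in 𝓝 0,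
      Phi R' (im t.1) (im t.2) * (Phi R (im t.1) 0 * Phi R 0 (im t.2))
        = Phi R (im t.1) (im t.2) * (Phi R' (im t.1) 0 * Phi R' 0 (im t.2))) :
    PhiIdentity R R' := by
  let H : (Fin d → ℂ) → (Fin d → ℂ) → ℂ := fun z₁ z₂ =>
    Phi R' z₁ z₂ * (Phi R z₁ 0 * Phi R 0 z₂) - Phi R z₁ z₂ * (Phi R' z₁ 0 * Phi R' 0 z₂)
  have hdiff (p₁ p₂ q₁ q₂ : Fin d → ℂ) :
      Differentiable ℂ fun s : ℂ => H (p₁ + s • q₁) (p₂ + s • q₂) := by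
    have hl {Q : PairLaw d} (h₁ : LightTail ρ (Q : Measure (E d × E d)).fst)
        (h₂ : LightTail ρ (Q : Measure (E d × E d)).snd) :
        Differentiable ℂ fun s : ℂ => Phi Q (p₁ + s • q₁) 0 := by
      simpa using differentiable_Phi h₁ h₂ p₁ 0 q₁ 0
    have hr {Q : PairLaw d} (h₁ : LightTail ρ (Q : Measure (E d × E d)).fst)
        (h₂ : LightTail ρ (Q : Measure (E d × E d)).snd) :
        Differentiable ℂ fun s : ℂ => Phi Q 0 (p₂ + s • q₂) := by
      simpa using differentiable_Phi h₁ h₂ 0 p₂ 0 q₂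
    exact ((differentiable_Phi h₁' h₂' p₁ p₂ q₁ q₂).mul ((hl h₁ h₂).mul (hr h₁ h₂))).sub
      ((differentiable_Phi h₁ h₂ p₁ p₂ q₁ q₂).mul ((hl h₁' h₂').mul (hr h₁' h₂')))
  -- First continuation: along `r ↦ r • (t₁, t₂)`, from small real `r` to `r = 1`.
  have hreal (t₁ t₂ : E d) : H (im t₁) (im t₂) = 0 := by
    have htend : Tendsto (fun r : ℝ => r • (t₁, t₂)) (𝓝 0) (𝓝 0) :=
      Continuous.tendsto' (by fun_prop) _ _ (by simp)
    have h0 := eq_zero_of_eventually_real (hdiff 0 0 (im t₁) (im t₂)) (by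
      filter_upwards [htend.eventually h] with r hr
      simp only [Prod.smul_mk, im_smul] at hr
      simpa [H, sub_eq_zero] using hr) 1
    simpa using h0
  intro z₁ z₂
  let τ : (Fin d → ℂ) → E d := fun z => WithLp.toLp 2 fun j => (z j).im
  let σ : (Fin d → ℂ) → E d := fun z => WithLp.toLp 2 fun j => (z j).re
  -- Second continuation: `im (τ z) + s • im (σ z)` is purely imaginary for real `s` and equals `z`
  -- at `s = -i`.
  have hz (z : Fin d → ℂ) : z = im (τ z) + (-Complex.I) • im (σ z) := by
    ext j
    simp only [im, τ, σ, Pi.add_apply, Pi.smul_apply, smul_eq_mul]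
    rw [← mul_assoc, neg_mul, Complex.I_mul_I, neg_neg, one_mul, add_comm, mul_comm Complex.I,
      Complex.re_add_im]
  have h0 := eq_zero_of_eventually_real (hdiff (im (τ z₁)) (im (τ z₂)) (im (σ z₁)) (im (σ z₂)))
    (Eventually.of_forall fun r => by
      rw [← im_smul, ← im_smul, ← im_add, ← im_add]
      exact hreal _ _) (-Complex.I)
  rw [← hz, ← hz] at h0
  exact sub_eq_zero.1 h0

lemma analyticOrderAt_le_of_mul_eq {A B f g : ℂ → ℂ} (hA : Differentiable ℂ A)
    (hB : Differentiable ℂ B) (hf : Differentiable ℂ f) (hg : Differentiable ℂ g) {s : ℂ}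
    (hBs : B s ≠ 0) (h : ∀ z, A z * f z = B z * g z) :
    analyticOrderAt f s ≤ analyticOrderAt g s := by
  have h1 : A * f = B * g := funext h
  have h2 := congrArg (fun F => analyticOrderAt F s) h1
  simp only [analyticOrderAt_mul (hA.analyticAt s) (hf.analyticAt s),
    analyticOrderAt_mul (hB.analyticAt s) (hg.analyticAt s),
    (hB.analyticAt s).analyticOrderAt_eq_zero.2 hBs, zero_add] at h2
  rw [← h2]
  exact le_add_self

/-- Dependency at `s₀ • q` gives a `z` where the joint transform of `R` is nonzero. Rescaling `z` to
`r • z` also makes a marginal transform of `R'` nonzero, since it is 1 at `r = 0`. With that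
variable frozen, the factor multiplying the marginal transform of `R'` in the identity has order 0
at `s₀`. -/
lemma PhiIdentity.analyticOrderAt_le (h : PhiIdentity R R')
    (h₁ : LightTail ρ (R : Measure (E d × E d)).fst)
    (h₂ : LightTail ρ (R : Measure (E d × E d)).snd)
    (h₁' : LightTail ρ (R' : Measure (E d × E d)).fst)
    (h₂' : LightTail ρ (R' : Measure (E d × E d)).snd)
    (hR : (R : Measure (E d × E d)).fst = (R : Measure (E d × E d)).snd)
    (hR' : (R' : Measure (E d × E d)).fst = (R' : Measure (E d × E d)).snd)
    (hdep : Dependency R) (q : Fin d → ℂ) (s₀ : ℂ) :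
    analyticOrderAt (fun s : ℂ => Phi R (s • q) 0) s₀
      ≤ analyticOrderAt (fun s : ℂ => Phi R' (s • q) 0) s₀ := by
  have hf := differentiable_Phi_left h₁ h₂ q 0
  have hg := differentiable_Phi_left h₁' h₂' q 0
  rcases hdep (s₀ • q) with ⟨z, hz⟩ | ⟨z, hz⟩
  · obtain ⟨r, hr, hr'⟩ := exists_ne_zero_of_entire
      (differentiable_Phi_right h₁ h₂ (s₀ • q) z) (differentiable_Phi_right h₁' h₂' 0 z)
      (a := 1) (b := 0) (by simpa using hz) (by simp [Phi_zero_zero])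
    refine analyticOrderAt_le_of_mul_eq
      (A := fun s => Phi R' (s • q) (r • z) * Phi R 0 (r • z))
      (B := fun s => Phi R (s • q) (r • z) * Phi R' 0 (r • z))
      ((differentiable_Phi_left h₁' h₂' q _).mul_const _)
      ((differentiable_Phi_left h₁ h₂ q _).mul_const _) hf hg (mul_ne_zero hr hr') fun s => ?_
    linear_combination h (s • q) (r • z)
  · obtain ⟨r, hr, hr'⟩ := exists_ne_zero_of_entire
      (differentiable_Phi_left h₁ h₂ z (s₀ • q)) (differentiable_Phi_left h₁' h₂' z 0)
      (a := 1) (b := 0) (by simpa using hz) (by simp [Phi_zero_zero])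
    -- Here the first variable is frozen, which compares second marginals; equality of the marginals
    -- transfers the result to the first.
    simp only [Phi_left_eq_right hR, Phi_left_eq_right hR'] at hf hg ⊢
    refine analyticOrderAt_le_of_mul_eq
      (A := fun s => Phi R' (r • z) (s • q) * Phi R (r • z) 0)
      (B := fun s => Phi R (r • z) (s • q) * Phi R' (r • z) 0)
      ((differentiable_Phi_right h₁' h₂' _ q).mul_const _)
      ((differentiable_Phi_right h₁ h₂ _ q).mul_const _) hf hg (mul_ne_zero hr hr') fun s => ?_
    linear_combination h (r • z) (s • q)

lemma PhiIdentity.Phi_left_eq_exp_mul (h : PhiIdentity R R') (hρ0 : 0 < ρ) (hρ : ρ < 2)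
    (h₁ : LightTail ρ (R : Measure (E d × E d)).fst)
    (h₂ : LightTail ρ (R : Measure (E d × E d)).snd)
    (h₁' : LightTail ρ (R' : Measure (E d × E d)).fst)
    (h₂' : LightTail ρ (R' : Measure (E d × E d)).snd)
    (hR : (R : Measure (E d × E d)).fst = (R : Measure (E d × E d)).snd)
    (hR' : (R' : Measure (E d × E d)).fst = (R' : Measure (E d × E d)).snd)
    (hdep : Dependency R) (hdep' : Dependency R') (t : E d) (s : ℂ) :
    Phi R (s • im t) 0
      = Complex.exp (Complex.I * ((inner ℝ t (mean R - mean R') : ℝ) : ℂ) * s)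
        * Phi R' (s • im t) 0 := by
  obtain ⟨K, hK⟩ := exists_norm_Phi_le hρ0 h₁ t
  obtain ⟨K', hK'⟩ := exists_norm_Phi_le hρ0 h₁' t
  have hmain := eq_exp_mul_of_analyticOrderAt_eq (K := max 1 (max K K'))
    (differentiable_Phi_left h₁ h₂ (im t) 0) (differentiable_Phi_left h₁' h₂' (im t) 0)
    (by simp [Phi_zero_zero]) (by simp [Phi_zero_zero])
    (fun z => le_antisymm (h.analyticOrderAt_le h₁ h₂ h₁' h₂' hR hR' hdep _ _)
      (h.symm.analyticOrderAt_le h₁' h₂' h₁ h₂ hR' hR hdep' _ _))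
    hρ (hK _ (by simp)) (hK' _ (by simp)) (by simp) s
  rw [deriv_Phi_left h₁ h₂, deriv_Phi_left h₁' h₂'] at hmain
  rw [hmain, inner_sub_right]
  push_cast
  ring_nf

/-- Substituting the exponential relation for both marginals in the identity gives `D * V = 0` on a
complex line, where `V` is the product of the marginal transforms of `R'`. As `V 0 = 1`, the entire
function `D` vanishes, even at zeros of `V`. -/
lemma PhiIdentity.Phi_im_eq (h : PhiIdentity R R') (hρ0 : 0 < ρ) (hρ : ρ < 2)
    (h₁ : LightTail ρ (R : Measure (E d × E d)).fst)
    (h₂ : LightTail ρ (R : Measure (E d × E d)).snd)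
    (h₁' : LightTail ρ (R' : Measure (E d × E d)).fst)
    (h₂' : LightTail ρ (R' : Measure (E d × E d)).snd)
    (hR : (R : Measure (E d × E d)).fst = (R : Measure (E d × E d)).snd)
    (hR' : (R' : Measure (E d × E d)).fst = (R' : Measure (E d × E d)).snd)
    (hdep : Dependency R) (hdep' : Dependency R') (t₁ t₂ : E d) :
    Phi R (im t₁) (im t₂)
      = Complex.exp (Complex.I * ((inner ℝ (t₁ + t₂) (mean R - mean R') : ℝ) : ℂ))
        * Phi R' (im t₁) (im t₂) := by
  set m := mean R - mean R'
  have hexp := h.Phi_left_eq_exp_mul hρ0 hρ h₁ h₂ h₁' h₂' hR hR' hdep hdep'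
  let c : ℂ := Complex.I * ((inner ℝ (t₁ + t₂) m : ℝ) : ℂ)
  let D : ℂ → ℂ := fun s =>
    Phi R (s • im t₁) (s • im t₂) - Complex.exp (c * s) * Phi R' (s • im t₁) (s • im t₂)
  let V : ℂ → ℂ := fun s => Phi R' (s • im t₁) 0 * Phi R' 0 (s • im t₂)
  have hD : Differentiable ℂ D := by
    have e1 : Differentiable ℂ fun s : ℂ => Phi R (s • im t₁) (s • im t₂) := by
      simpa using differentiable_Phi h₁ h₂ 0 0 (im t₁) (im t₂)
    have e2 : Differentiable ℂ fun s : ℂ => Phi R' (s • im t₁) (s • im t₂) := by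
      simpa using differentiable_Phi h₁' h₂' 0 0 (im t₁) (im t₂)
    exact e1.sub ((Differentiable.cexp (by fun_prop)).mul e2)
  have hV : Differentiable ℂ V :=
    (differentiable_Phi_left h₁' h₂' _ 0).mul (differentiable_Phi_right h₁' h₂' 0 _)
  have hDV (s : ℂ) : D s * V s = 0 := by
    have hid := h (s • im t₁) (s • im t₂)
    have e1 := hexp t₁ s
    have e2 : Phi R 0 (s • im t₂) = Complex.exp (Complex.I * ((inner ℝ t₂ m : ℝ) : ℂ) * s)
        * Phi R' 0 (s • im t₂) := by
      rw [← Phi_left_eq_right hR, ← Phi_left_eq_right hR']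
      exact hexp t₂ s
    have e3 : Complex.exp (c * s) = Complex.exp (Complex.I * ((inner ℝ t₁ m : ℝ) : ℂ) * s)
        * Complex.exp (Complex.I * ((inner ℝ t₂ m : ℝ) : ℂ) * s) := by
      rw [← Complex.exp_add]
      simp only [c, inner_add_left]
      push_cast
      ring_nf
    simp only [D, V]
    rw [e1, e2] at hid
    rw [e3]
    linear_combination -hid
  have hD1 : D 1 = 0 := by
    by_contra hne
    obtain ⟨s, hs, hs'⟩ := exists_ne_zero_of_entire hD hV (a := 1) (b := 0) hne
      (by simp [V, Phi_zero_zero])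
    exact mul_ne_zero hs hs' (hDV s)
  simpa [D, c, sub_eq_zero] using hD1

lemma exists_charFunDual_eq_Phi (L : StrongDual ℝ (E d × E d)) :
    ∃ t₁ t₂ : E d, (∀ x, L x = inner ℝ t₁ x.1 + inner ℝ t₂ x.2) ∧
      ∀ R : PairLaw d, charFunDual (R : Measure (E d × E d)) L = Phi R (im t₁) (im t₂) := by
  refine ⟨(InnerProductSpace.toDual ℝ (E d)).symm (L.comp (.inl ℝ _ _)),
    (InnerProductSpace.toDual ℝ (E d)).symm (L.comp (.inr ℝ _ _)), ?_⟩
  have hL (x : E d × E d) :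
      L x = inner ℝ ((InnerProductSpace.toDual ℝ (E d)).symm (L.comp (.inl ℝ _ _))) x.1
        + inner ℝ ((InnerProductSpace.toDual ℝ (E d)).symm (L.comp (.inr ℝ _ _))) x.2 := by
    simp only [InnerProductSpace.toDual_symm_apply]
    exact (L.comp_inl_add_comp_inr x).symm
  refine ⟨hL, fun R => ?_⟩
  rw [charFunDual_apply, Phi_eq]
  congr 1 with x
  rw [linForm_im, hL x, mul_comm]

lemma PhiIdentity.eqUpToTranslation (h : PhiIdentity R R') (hρ0 : 0 < ρ) (hρ : ρ < 2)
    (h₁ : LightTail ρ (R : Measure (E d × E d)).fst)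
    (h₂ : LightTail ρ (R : Measure (E d × E d)).snd)
    (h₁' : LightTail ρ (R' : Measure (E d × E d)).fst)
    (h₂' : LightTail ρ (R' : Measure (E d × E d)).snd)
    (hR : (R : Measure (E d × E d)).fst = (R : Measure (E d × E d)).snd)
    (hR' : (R' : Measure (E d × E d)).fst = (R' : Measure (E d × E d)).snd)
    (hdep : Dependency R) (hdep' : Dependency R') : EqUpToTranslation R R' := by
  set m := mean R - mean R' with hm
  refine ⟨m, ?_⟩
  have hmap : (fun x : E d × E d => (x.1 - m, x.2 - m)) = fun x => x + (-m, -m) := by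
    ext x <;> simp [sub_eq_add_neg]
  rw [hmap]
  have : IsProbabilityMeasure ((R : Measure (E d × E d)).map (· + ((-m, -m) : E d × E d))) :=
    Measure.isProbabilityMeasure_map (by fun_prop)
  refine Measure.ext_of_charFunDual (funext fun L => ?_)
  obtain ⟨t₁, t₂, hL, hchar⟩ := exists_charFunDual_eq_Phi L
  rw [charFunDual_map_add_const, hchar, hchar,
    h.Phi_im_eq hρ0 hρ h₁ h₂ h₁' h₂' hR hR' hdep hdep', hL, mul_right_comm, ← Complex.exp_add,
    ← hm]
  simp only [inner_neg_right, inner_add_left]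
  push_cast
  ring_nf
  simp

lemma continuous_Phi_im_left (Q : PairLaw d) :
    Continuous fun t : E d × E d => Phi Q (im t.1) 0 := by
  have h := (continuous_Phi_im Q).comp
    (by fun_prop : Continuous fun t : E d × E d => (t.1, (0 : E d)))
  simpa [Function.comp_def, im_zero] using h

lemma continuous_Phi_im_right (Q : PairLaw d) :
    Continuous fun t : E d × E d => Phi Q 0 (im t.2) := by
  have h := (continuous_Phi_im Q).comp
    (by fun_prop : Continuous fun t : E d × E d => ((0 : E d), t.2))
  simpa [Function.comp_def, im_zero] using h

lemma aemeasurable_crit_integrand {S : Set (E d × E d)} {w : E d × E d → ℝ}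
    (hwint : IntegrableOn w S) (R' R : PairLaw d) (Pstar : ProbabilityMeasure (E d)) :
    AEMeasurable (fun t : E d × E d =>
      ‖Phi R' (im t.1) (im t.2) * Phi R (im t.1) 0 * Phi R 0 (im t.2)
        - Phi R (im t.1) (im t.2) * Phi R' (im t.1) 0 * Phi R' 0 (im t.2)‖ₑ ^ 2
      * ‖charFun (Pstar : Measure (E d)) t.1 * charFun (Pstar : Measure (E d)) t.2‖ₑ ^ 2
      * ENNReal.ofReal (w t)) (volume.restrict S) := by
  have hφ : Continuous (charFun (Pstar : Measure (E d))) := continuous_charFun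
  have h₁ : Continuous fun t : E d × E d =>
      Phi R' (im t.1) (im t.2) * Phi R (im t.1) 0 * Phi R 0 (im t.2)
        - Phi R (im t.1) (im t.2) * Phi R' (im t.1) 0 * Phi R' 0 (im t.2) :=
    (((continuous_Phi_im R').mul (continuous_Phi_im_left R)).mul (continuous_Phi_im_right R)).sub
      (((continuous_Phi_im R).mul (continuous_Phi_im_left R')).mul (continuous_Phi_im_right R'))
  have h₂ : Continuous fun t : E d × E d =>
      charFun (Pstar : Measure (E d)) t.1 * charFun (Pstar : Measure (E d)) t.2 := by fun_prop
  exact ((h₁.enorm.aemeasurable.pow_const 2).mul (h₂.enorm.aemeasurable.pow_const 2)).mul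
    hwint.aemeasurable.ennreal_ofReal

/-- A law whose criterion vanishes is the true law up to translation. -/
theorem eqUpToTranslation_of_crit_eq_zero {S : Set (E d × E d)}
    (hS0 : S ∈ 𝓝 0) {w : E d × E d → ℝ} (hw : ∀ t ∈ S, 0 < w t) (hwint : IntegrableOn w S)
    (Pstar : ProbabilityMeasure (E d)) (hρ0 : 0 < ρ) (hρ : ρ < 2)
    (h₁ : LightTail ρ (R : Measure (E d × E d)).fst)
    (h₂ : LightTail ρ (R : Measure (E d × E d)).snd)
    (h₁' : LightTail ρ (R' : Measure (E d × E d)).fst)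
    (h₂' : LightTail ρ (R' : Measure (E d × E d)).snd)
    (hR : (R : Measure (E d × E d)).fst = (R : Measure (E d × E d)).snd)
    (hR' : (R' : Measure (E d × E d)).fst = (R' : Measure (E d × E d)).snd)
    (hdep : Dependency R) (hdep' : Dependency R') (hcrit : crit S w R' Pstar R = 0) :
    EqUpToTranslation R R' := by
  let φ : E d → ℂ := charFun (Pstar : Measure (E d))
  have hφ : Continuous φ := continuous_charFun
  let F₁ : E d × E d → ℂ := fun t =>
    Phi R' (im t.1) (im t.2) * (Phi R (im t.1) 0 * Phi R 0 (im t.2))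
  let F₂ : E d × E d → ℂ := fun t =>
    Phi R (im t.1) (im t.2) * (Phi R' (im t.1) 0 * Phi R' 0 (im t.2))
  have hF₁ : Continuous F₁ := (continuous_Phi_im R').mul
    ((continuous_Phi_im_left R).mul (continuous_Phi_im_right R))
  have hF₂ : Continuous F₂ := (continuous_Phi_im R).mul
    ((continuous_Phi_im_left R').mul (continuous_Phi_im_right R'))
  have hφ0 : ∀ᶠ t : E d × E d in 𝓝 0, φ t.1 * φ t.2 ≠ 0 := by
    have hc : Continuous fun t : E d × E d => φ t.1 * φ t.2 := by fun_prop
    exact hc.continuousAt.eventually_ne (by simp [φ])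
  obtain ⟨U, hUsub, hUo, hU0⟩ := mem_nhds_iff.1 (Filter.inter_mem hS0 hφ0)
  refine PhiIdentity.eqUpToTranslation (phiIdentity_of_eventually h₁ h₂ h₁' h₂' ?_) hρ0 hρ
    h₁ h₂ h₁' h₂' hR hR' hdep hdep'
  have hae : F₁ =ᵐ[volume.restrict U] F₂ := by
    rw [crit, lintegral_eq_zero_iff' (aemeasurable_crit_integrand hwint _ _ _)] at hcrit
    have hcritU := ae_restrict_of_ae_restrict_of_subset (hUsub.trans Set.inter_subset_left) hcrit
    filter_upwards [hcritU, ae_restrict_mem hUo.measurableSet] with t ht htU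
    have hwt := hw t (hUsub htU).1
    have hφt : φ t.1 * φ t.2 ≠ 0 := (hUsub htU).2
    have hφt' : ‖φ t.1 * φ t.2‖ₑ ^ 2 ≠ 0 := by simpa using hφt
    simp only [Pi.zero_apply, mul_eq_zero, ENNReal.ofReal_eq_zero, not_le.2 hwt, or_false] at ht
    have := ht.resolve_right hφt'
    rw [pow_eq_zero_iff two_ne_zero, enorm_eq_zero, sub_eq_zero, mul_assoc, mul_assoc] at this
    exact this
  -- Continuous functions equal almost everywhere on an open set are equal on it.
  filter_upwards [hUo.mem_nhds hU0] with t ht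
  exact Measure.eqOn_open_of_ae_eq hae hUo hF₁.continuousOn hF₂.continuousOn ht

end Identification

end HiddenTranslation

end

noncomputable section

namespace HiddenTranslation

/-! ### Stability of the criterion, rate and convergence in probability. -/

section Estimation

variable {d : ℕ}

/-- The characteristic function of two consecutive observations. -/
def obsCharFun (Rstar : PairLaw d) (Pstar : ProbabilityMeasure (E d)) (t : E d × E d) : ℂ :=
  Phi Rstar (im t.1) (im t.2) * charFun (Pstar : Measure (E d)) t.1
    * charFun (Pstar : Measure (E d)) t.2

/-- The function whose weighted square norm is the least squares criterion. -/
def residual (ψ : E d × E d → ℂ) (R : PairLaw d) (t : E d × E d) : ℂ :=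
  ψ t * Phi R (im t.1) 0 * Phi R 0 (im t.2) - Phi R (im t.1) (im t.2) * ψ (t.1, 0) * ψ (0, t.2)

lemma obsCharFun_left (Rstar : PairLaw d) (Pstar : ProbabilityMeasure (E d)) (t : E d) :
    obsCharFun Rstar Pstar (t, 0) = Phi Rstar (im t) 0 * charFun (Pstar : Measure (E d)) t := by
  simp [obsCharFun, im_zero]

lemma obsCharFun_right (Rstar : PairLaw d) (Pstar : ProbabilityMeasure (E d)) (t : E d) :
    obsCharFun Rstar Pstar (0, t) = Phi Rstar 0 (im t) * charFun (Pstar : Measure (E d)) t := by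
  simp [obsCharFun, im_zero]

lemma norm_obsCharFun_le_one (Rstar : PairLaw d) (Pstar : ProbabilityMeasure (E d))
    (t : E d × E d) : ‖obsCharFun Rstar Pstar t‖ ≤ 1 := by
  rw [obsCharFun, norm_mul, norm_mul]
  exact mul_le_one₀ (mul_le_one₀ (norm_Phi_im_le_one _ _ _) (norm_nonneg _) (norm_charFun_le_one _))
    (norm_nonneg _) (norm_charFun_le_one _)

lemma residual_obsCharFun (Rstar R : PairLaw d) (Pstar : ProbabilityMeasure (E d))
    (t : E d × E d) :
    residual (obsCharFun Rstar Pstar) R t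
      = (Phi Rstar (im t.1) (im t.2) * Phi R (im t.1) 0 * Phi R 0 (im t.2)
          - Phi R (im t.1) (im t.2) * Phi Rstar (im t.1) 0 * Phi Rstar 0 (im t.2))
        * (charFun (Pstar : Measure (E d)) t.1 * charFun (Pstar : Measure (E d)) t.2) := by
  rw [residual, obsCharFun_left, obsCharFun_right, obsCharFun]
  ring

/-- The population criterion is the empirical criterion at the true characteristic function. -/
lemma crit_eq_empCrit (S : Set (E d × E d)) (w : E d × E d → ℝ) (Rstar : PairLaw d)
    (Pstar : ProbabilityMeasure (E d)) (R : PairLaw d) :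
    crit S w Rstar Pstar R = empCrit S w (obsCharFun Rstar Pstar) R := by
  refine lintegral_congr fun t => ?_
  change _ = ‖residual (obsCharFun Rstar Pstar) R t‖ₑ ^ 2 * _
  rw [residual_obsCharFun, enorm_mul _ (_ * _), mul_pow]

lemma residual_obsCharFun_self (Rstar : PairLaw d) (Pstar : ProbabilityMeasure (E d))
    (t : E d × E d) : residual (obsCharFun Rstar Pstar) Rstar t = 0 := by
  rw [residual_obsCharFun]
  ring

/-- The residual is affine in the joint value and quadratic in the marginal values of `ψ`: three
errors of first order and one of second give `3δ + δ²`. -/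
lemma norm_residual_sub_le {ψ Ψ : E d × E d → ℂ} (R : PairLaw d) {t : E d × E d} {δ : ℝ}
    (hΨ : ∀ t, ‖Ψ t‖ ≤ 1) (h : ‖ψ t - Ψ t‖ ≤ δ) (h₁ : ‖ψ (t.1, 0) - Ψ (t.1, 0)‖ ≤ δ)
    (h₂ : ‖ψ (0, t.2) - Ψ (0, t.2)‖ ≤ δ) :
    ‖residual ψ R t - residual Ψ R t‖ ≤ δ * (3 + δ) := by
  have hδ : 0 ≤ δ := (norm_nonneg _).trans h
  have hF := norm_Phi_im_le_one R t.1 t.2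
  have hf : ‖Phi R (im t.1) 0‖ ≤ 1 := by simpa [im_zero] using norm_Phi_im_le_one R t.1 0
  have hg : ‖Phi R 0 (im t.2)‖ ≤ 1 := by simpa [im_zero] using norm_Phi_im_le_one R 0 t.2
  have hdecomp : residual ψ R t - residual Ψ R t
      = (ψ t - Ψ t) * (Phi R (im t.1) 0 * Phi R 0 (im t.2))
        - Phi R (im t.1) (im t.2) * ((ψ (t.1, 0) - Ψ (t.1, 0)) * Ψ (0, t.2)
          + Ψ (t.1, 0) * (ψ (0, t.2) - Ψ (0, t.2))
          + (ψ (t.1, 0) - Ψ (t.1, 0)) * (ψ (0, t.2) - Ψ (0, t.2))) := by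
    simp only [residual]
    ring
  have e1 : ‖(ψ t - Ψ t) * (Phi R (im t.1) 0 * Phi R 0 (im t.2))‖ ≤ δ * 1 := by
    rw [norm_mul, norm_mul]
    exact mul_le_mul h (mul_le_one₀ hf (norm_nonneg _) hg) (by positivity) hδ
  have e2 : ‖(ψ (t.1, 0) - Ψ (t.1, 0)) * Ψ (0, t.2)‖ ≤ δ * 1 := by
    rw [norm_mul]
    exact mul_le_mul h₁ (hΨ _) (norm_nonneg _) hδ
  have e3 : ‖Ψ (t.1, 0) * (ψ (0, t.2) - Ψ (0, t.2))‖ ≤ 1 * δ := by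
    rw [norm_mul]
    exact mul_le_mul (hΨ _) h₂ (norm_nonneg _) zero_le_one
  have e4 : ‖(ψ (t.1, 0) - Ψ (t.1, 0)) * (ψ (0, t.2) - Ψ (0, t.2))‖ ≤ δ * δ := by
    rw [norm_mul]
    exact mul_le_mul h₁ h₂ (norm_nonneg _) hδ
  rw [hdecomp]
  refine (norm_sub_le _ _).trans ?_
  have e5 := (norm_mul_le (Phi R (im t.1) (im t.2)) ((ψ (t.1, 0) - Ψ (t.1, 0)) * Ψ (0, t.2)
          + Ψ (t.1, 0) * (ψ (0, t.2) - Ψ (0, t.2))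
          + (ψ (t.1, 0) - Ψ (t.1, 0)) * (ψ (0, t.2) - Ψ (0, t.2)))).trans
    (mul_le_of_le_one_left (norm_nonneg _) hF)
  have e6 := norm_add₃_le (a := (ψ (t.1, 0) - Ψ (t.1, 0)) * Ψ (0, t.2))
    (b := Ψ (t.1, 0) * (ψ (0, t.2) - Ψ (0, t.2)))
    (c := (ψ (t.1, 0) - Ψ (t.1, 0)) * (ψ (0, t.2) - Ψ (0, t.2)))
  linarith

lemma enorm_sq_le_ofReal {z : ℂ} {c : ℝ} (h : ‖z‖ ≤ c) : ‖z‖ₑ ^ 2 ≤ ENNReal.ofReal (c ^ 2) := by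
  rw [← ofReal_norm, ← ENNReal.ofReal_pow (norm_nonneg _)]
  exact ENNReal.ofReal_le_ofReal (pow_le_pow_left₀ (norm_nonneg _) h 2)

lemma enorm_sq_le_of_norm_sub_le {a b : ℂ} {c : ℝ} (h : ‖a - b‖ ≤ c) :
    ‖a‖ₑ ^ 2 ≤ 2 * ‖b‖ₑ ^ 2 + ENNReal.ofReal (2 * c ^ 2) := by
  have h2 : ‖a‖ ^ 2 ≤ 2 * ‖b‖ ^ 2 + 2 * c ^ 2 := by
    have h3 : ‖a‖ ≤ ‖b‖ + c := by linarith [norm_sub_norm_le a b]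
    nlinarith [norm_nonneg a, norm_nonneg b, sq_nonneg (‖b‖ - c)]
  rw [← ofReal_norm, ← ofReal_norm, ← ENNReal.ofReal_pow (norm_nonneg _),
    ← ENNReal.ofReal_pow (norm_nonneg _), ← ENNReal.ofReal_ofNat 2,
    ← ENNReal.ofReal_mul (by norm_num), ← ENNReal.ofReal_add (by positivity) (by positivity)]
  exact ENNReal.ofReal_le_ofReal h2

section Deterministic

variable {S : Set (E d × E d)} {w : E d × E d → ℝ}

lemma lintegral_const_mul_weight (hS : IsCompact S) (hw : ∀ t ∈ S, 0 < w t)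
    (hwint : IntegrableOn w S) {c : ℝ} (hc : 0 ≤ c) :
    ∫⁻ t in S, ENNReal.ofReal c * ENNReal.ofReal (w t)
      = ENNReal.ofReal (c * ∫ t in S, w t) := by
  rw [lintegral_const_mul' _ _ ENNReal.ofReal_ne_top, ENNReal.ofReal_mul hc,
    ofReal_integral_eq_lintegral_ofReal hwint
      ((ae_restrict_iff' hS.measurableSet).2 (Eventually.of_forall fun t ht => (hw t ht).le))]

/-- A minimizer of the empirical criterion almost minimizes the population criterion when the
empirical characteristic function is uniformly close to the true one. -/
lemma crit_le_of_uniform_close (hS : IsCompact S) (hSproj : ∀ t ∈ S, (t.1, 0) ∈ S ∧ (0, t.2) ∈ S)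
    (hw : ∀ t ∈ S, 0 < w t) (hwint : IntegrableOn w S) {Rstar R : PairLaw d}
    {Pstar : ProbabilityMeasure (E d)} {ψ : E d × E d → ℂ} {δ : ℝ}
    (hψ : ∀ t ∈ S, ‖ψ t - obsCharFun Rstar Pstar t‖ ≤ δ)
    (hR : empCrit S w ψ R ≤ empCrit S w ψ Rstar) :
    crit S w Rstar Pstar R ≤ ENNReal.ofReal (4 * (δ * (3 + δ)) ^ 2 * ∫ t in S, w t) := by
  set c := δ * (3 + δ)
  set W := ∫ t in S, w t
  have hW : 0 ≤ W := setIntegral_nonneg hS.measurableSet fun t ht => (hw t ht).le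
  have hres (Q : PairLaw d) (t : E d × E d) (ht : t ∈ S) :
      ‖residual ψ Q t - residual (obsCharFun Rstar Pstar) Q t‖ ≤ c :=
    norm_residual_sub_le Q (norm_obsCharFun_le_one Rstar Pstar) (hψ t ht)
      (hψ _ (hSproj t ht).1) (hψ _ (hSproj t ht).2)
  have hstar : empCrit S w ψ Rstar ≤ ENNReal.ofReal (c ^ 2 * W) := by
    rw [← lintegral_const_mul_weight hS hw hwint (sq_nonneg c)]
    refine setLIntegral_mono' hS.measurableSet fun t ht => ?_
    gcongr
    refine enorm_sq_le_ofReal ?_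
    have h := hres Rstar t ht
    rwa [residual_obsCharFun_self, sub_zero] at h
  have hconst : AEMeasurable (fun t => ENNReal.ofReal (2 * c ^ 2) * ENNReal.ofReal (w t))
      (volume.restrict S) := hwint.aemeasurable.ennreal_ofReal.const_mul _
  rw [crit_eq_empCrit]
  -- `‖a‖² ≤ 2‖b‖² + 2‖a - b‖²` passes to the empirical criterion of `R`, which minimality bounds by
  -- that of the true law, at most `c² W`; hence `4 = 2 + 2`.
  calc empCrit S w (obsCharFun Rstar Pstar) R
      ≤ ∫⁻ t in S, (2 * (‖residual ψ R t‖ₑ ^ 2 * ENNReal.ofReal (w t))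
          + ENNReal.ofReal (2 * c ^ 2) * ENNReal.ofReal (w t)) := by
        refine setLIntegral_mono' hS.measurableSet fun t ht => ?_
        rw [← mul_assoc, ← add_mul]
        gcongr
        refine enorm_sq_le_of_norm_sub_le ?_
        rw [norm_sub_rev]
        exact hres R t ht
    _ = 2 * empCrit S w ψ R + ENNReal.ofReal (2 * c ^ 2 * W) := by
        rw [lintegral_add_right' _ hconst, lintegral_const_mul' _ _ ENNReal.ofNat_ne_top,
          lintegral_const_mul_weight hS hw hwint (by positivity)]
        rfl
    _ ≤ ENNReal.ofReal 2 * ENNReal.ofReal (c ^ 2 * W) + ENNReal.ofReal (2 * c ^ 2 * W) := by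
        rw [ENNReal.ofReal_ofNat]
        gcongr
        exact hR.trans hstar
    _ = ENNReal.ofReal (4 * c ^ 2 * W) := by
        rw [← ENNReal.ofReal_mul (by norm_num),
          ← ENNReal.ofReal_add (by positivity) (by positivity)]
        ring_nf

/-- The population criterion is sequentially lower semicontinuous for weak convergence. -/
lemma crit_le_liminf (hwint : IntegrableOn w S) (Rstar : PairLaw d)
    (Pstar : ProbabilityMeasure (E d)) {u : ℕ → PairLaw d} {R : PairLaw d}
    (hu : Tendsto u atTop (𝓝 R)) :
    crit S w Rstar Pstar R ≤ liminf (fun k => crit S w Rstar Pstar (u k)) atTop := by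
  -- Fatou's lemma: the integrand converges pointwise, since `Phi` at imaginary points is the
  -- integral of a bounded continuous function.
  refine le_trans (lintegral_mono fun t => ?_)
    (lintegral_liminf_le' fun k => aemeasurable_crit_integrand hwint Rstar (u k) Pstar)
  have hPhi (t₁ t₂ : E d) : Tendsto (fun k => Phi (u k) (im t₁) (im t₂)) atTop
      (𝓝 (Phi R (im t₁) (im t₂))) :=
    ((continuous_Phi_im_law t₁ t₂).tendsto R).comp hu
  have hl := hPhi t.1 0
  have hr := hPhi 0 t.2
  rw [im_zero] at hl hr
  have h := ((((hl.const_mul (Phi Rstar (im t.1) (im t.2))).mul hr).sub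
    (((hPhi t.1 t.2).mul_const (Phi Rstar (im t.1) 0)).mul_const (Phi Rstar 0 (im t.2)))).enorm)
  have h2 := ENNReal.Tendsto.pow (n := 2) h
  have h3 := ENNReal.Tendsto.mul_const (b := ENNReal.ofReal (w t))
    (ENNReal.Tendsto.mul_const
      (b := ‖charFun (Pstar : Measure (E d)) t.1 * charFun (Pstar : Measure (E d)) t.2‖ₑ ^ 2) h2
      (Or.inr (ENNReal.pow_ne_top enorm_ne_top))) (Or.inr ENNReal.ofReal_ne_top)
  exact h3.liminf_eq.ge

end Deterministic

/-- On the event where the process is bounded by `K`, the uniform error is `K / √n`, so the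
criterion is in fact of order `1/n`; one factor `(√n)⁻¹ ≤ 1` is dropped. -/
lemma IsBigOInProb.crit {Ω : Type*} [MeasurableSpace Ω] {Pr : Measure Ω}
    {S : Set (E d × E d)} {w : E d × E d → ℝ} (hS : IsCompact S)
    (hSproj : ∀ t ∈ S, (t.1, 0) ∈ S ∧ (0, t.2) ∈ S)
    (hw : ∀ t ∈ S, 0 < w t) (hwint : IntegrableOn w S) {Rstar : PairLaw d}
    {Pstar : ProbabilityMeasure (E d)} {ψ : ℕ → Ω → E d × E d → ℂ} {Rhat : ℕ → Ω → PairLaw d}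
    (hR : ∀ n, 1 ≤ n → ∀ ω, empCrit S w (ψ n ω) (Rhat n ω) ≤ empCrit S w (ψ n ω) Rstar)
    (hZ : IsBigOInProb Pr (fun n ω => ⨆ t ∈ S, ‖Z Rstar Pstar n (ψ n ω) t‖ₑ) (fun _ => 1)) :
    IsBigOInProb Pr (fun n ω => crit S w Rstar Pstar (Rhat n ω))
      (fun n => (n : ℝ) ^ (-(1 / 2) : ℝ)) := by
  intro η hη
  obtain ⟨C, hC⟩ := hZ η hη
  set K := max C 0
  set W := ∫ t in S, w t
  have hW : 0 ≤ W := setIntegral_nonneg hS.measurableSet fun t ht => (hw t ht).le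
  have hK : 0 ≤ K := le_max_right _ _
  refine ⟨4 * (K * (3 + K)) ^ 2 * W, ?_⟩
  filter_upwards [hC, eventually_ge_atTop 1] with n hn hn1
  refine (measure_mono fun ω hω => ?_).trans hn
  simp only [Set.mem_ofPred_eq, mul_one] at hω ⊢
  by_contra! hle
  refine hω.not_ge ?_
  have hn1' : (1 : ℝ) ≤ n := by exact_mod_cast hn1
  have hsq1 : 1 ≤ √(n : ℝ) := Real.one_le_sqrt.2 hn1'
  have hψ (t : E d × E d) (ht : t ∈ S) : ‖ψ n ω t - obsCharFun Rstar Pstar t‖ ≤ K / √n := by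
    have h1 : ‖Z Rstar Pstar n (ψ n ω) t‖ₑ ≤ ENNReal.ofReal C :=
      (le_iSup₂ (f := fun t (_ : t ∈ S) => ‖Z Rstar Pstar n (ψ n ω) t‖ₑ) t ht).trans hle
    rw [← ofReal_norm] at h1
    have h2 : ‖Z Rstar Pstar n (ψ n ω) t‖ ≤ K := by
      refine (ENNReal.ofReal_le_ofReal_iff hK).1 (h1.trans ?_)
      exact ENNReal.ofReal_le_ofReal (le_max_left _ _)
    rw [Z, norm_mul, Complex.norm_real, Real.norm_of_nonneg (by positivity)] at h2
    rw [le_div_iff₀ (by linarith), mul_comm]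
    exact h2
  refine (crit_le_of_uniform_close hS hSproj hw hwint hψ (hR n hn1 ω)).trans ?_
  refine ENNReal.ofReal_le_ofReal ?_
  have hpow : (n : ℝ) ^ (-(1 / 2) : ℝ) = (√n)⁻¹ := by
    rw [Real.rpow_neg (by positivity), Real.sqrt_eq_rpow]
  have hδ : K / √n ≤ K := div_le_self hK hsq1
  have hδ0 : 0 ≤ K / √n := by positivity
  have hinv : (√(n : ℝ))⁻¹ ≤ 1 := inv_le_one_of_one_le₀ hsq1
  have hinv0 : 0 ≤ (√(n : ℝ))⁻¹ := by positivity
  rw [hpow]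
  have h5 : K / √n * (3 + K / √n) ≤ (K * (3 + K)) * (√n)⁻¹ := by
    calc K / √n * (3 + K / √n) ≤ K / √n * (3 + K) := by gcongr
      _ = _ := by ring
  have h6 : (K / √n * (3 + K / √n)) ^ 2 ≤ (K * (3 + K)) ^ 2 * (√n)⁻¹ := by
    calc (K / √n * (3 + K / √n)) ^ 2 ≤ ((K * (3 + K)) * (√n)⁻¹) ^ 2 := by gcongr
      _ = (K * (3 + K)) ^ 2 * ((√n)⁻¹ * (√n)⁻¹) := by ring
      _ ≤ (K * (3 + K)) ^ 2 * ((√n)⁻¹ * 1) := by gcongr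
      _ = _ := by ring
  calc 4 * (K / √n * (3 + K / √n)) ^ 2 * W ≤ 4 * ((K * (3 + K)) ^ 2 * (√n)⁻¹) * W := by gcongr
    _ = _ := by ring

/-- Random points of a compact metric space at which a lower semicontinuous function tends to zero
in probability converge in probability to its set of zeros. -/
lemma tendstoInMeasure_infDist {Ω T : Type*} [MeasurableSpace Ω] {Pr : Measure Ω} [MetricSpace T]
    [CompactSpace T] {c : T → ℝ≥0∞} {A : Set T}
    (hlsc : ∀ (u : ℕ → T) (x : T), Tendsto u atTop (𝓝 x) →
      c x ≤ liminf (fun k => c (u k)) atTop)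
    (hzero : ∀ x, c x = 0 → x ∈ A) {r : ℕ → ℝ} (hr : Tendsto r atTop (𝓝 0)) {X : ℕ → Ω → T}
    (hX : IsBigOInProb Pr (fun n ω => c (X n ω)) r) :
    TendstoInMeasure Pr (fun n ω => Metric.infDist (X n ω) A) atTop (fun _ => (0 : ℝ)) := by
  rw [tendstoInMeasure_iff_norm]
  intro ε hε
  -- Otherwise points at distance at least `ε` from `A` have values tending to 0; by compactness and
  -- lower semicontinuity a cluster point is a zero, hence in `A`.
  obtain ⟨κ, hκ, hsep⟩ : ∃ κ : ℝ, 0 < κ ∧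
      ∀ x, ε ≤ Metric.infDist x A → ENNReal.ofReal κ ≤ c x := by
    by_contra! hcon
    choose u hu hcu using fun k : ℕ => hcon (1 / ((k : ℝ) + 1)) (by positivity)
    obtain ⟨x, φ, hφ, hx⟩ := CompactSpace.tendsto_subseq u
    have hlim : Tendsto (fun k => c (u (φ k))) atTop (𝓝 0) := by
      have h1 : Tendsto (fun k : ℕ => ENNReal.ofReal (1 / ((k : ℝ) + 1))) atTop (𝓝 0) := by
        simpa using ENNReal.tendsto_ofReal (tendsto_one_div_add_atTop_nhds_zero_nat (𝕜 := ℝ))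
      exact tendsto_of_tendsto_of_tendsto_of_le_of_le tendsto_const_nhds
        (h1.comp hφ.tendsto_atTop) (fun _ => zero_le) fun k => (hcu (φ k)).le
    have hcx : c x = 0 := by
      have := hlsc (u ∘ φ) x hx
      simp only [Function.comp_apply, hlim.liminf_eq] at this
      exact le_antisymm this zero_le
    have hge : ε ≤ Metric.infDist x A :=
      ge_of_tendsto ((Metric.continuous_infDist_pt A).continuousAt.tendsto.comp hx)
        (Eventually.of_forall fun k => hu (φ k))
    rw [Metric.infDist_zero_of_mem (hzero x hcx)] at hge
    linarith
  rw [ENNReal.tendsto_nhds_zero]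
  intro η hη
  -- Capping by 1 makes the level finite, hence a real number.
  have hη' : min η 1 ≠ ⊤ := ne_top_of_le_ne_top ENNReal.one_ne_top (min_le_right _ _)
  have hηpos : 0 < (min η 1).toReal := ENNReal.toReal_pos (lt_min hη one_pos).ne' hη'
  obtain ⟨C, hC⟩ := hX _ hηpos
  have hCr : ∀ᶠ n in atTop, C * r n < κ := by
    have h := hr.const_mul C
    rw [mul_zero] at h
    exact h.eventually_lt_const hκ
  filter_upwards [hC, hCr] with n hn hnκ
  rw [ENNReal.ofReal_toReal hη'] at hn
  refine (measure_mono fun ω hω => ?_).trans (hn.trans (min_le_left _ _))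
  simp only [Set.mem_ofPred_eq, sub_zero, Real.norm_of_nonneg Metric.infDist_nonneg] at hω ⊢
  exact ((ENNReal.ofReal_lt_ofReal_iff hκ).2 hnκ).trans_le (hsep _ hω)

/-- `replaceTopology` makes the topology of `D` definitionally the weak one, so that compactness and
semicontinuity apply to it. -/
lemma tendstoInMeasure_distToSet {Ω : Type*} [MeasurableSpace Ω] {Pr : Measure Ω}
    {𝓡 : Set (PairLaw d)} (h𝓡 : IsCompact 𝓡) (D : MetricSpace 𝓡)
    (hD : MetrizesWeakConvergence 𝓡 D) {c : PairLaw d → ℝ≥0∞} {A : Set 𝓡}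
    (hlsc : ∀ (u : ℕ → PairLaw d) (R : PairLaw d), Tendsto u atTop (𝓝 R) →
      c R ≤ liminf (fun k => c (u k)) atTop)
    (hzero : ∀ R : 𝓡, c R = 0 → R ∈ A) {r : ℕ → ℝ} (hr : Tendsto r atTop (𝓝 0))
    {X : ℕ → Ω → 𝓡} (hX : IsBigOInProb Pr (fun n ω => c (X n ω)) r) :
    TendstoInMeasure Pr (fun n ω => distToSet D (X n ω) A) atTop (fun _ => (0 : ℝ)) := by
  have : CompactSpace 𝓡 := isCompact_iff_compactSpace.1 h𝓡
  rw [← MetricSpace.replaceTopology_eq D hD.symm]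
  let := D.replaceTopology hD.symm
  exact tendstoInMeasure_infDist (c := fun R : 𝓡 => c R)
    (fun u x hu => hlsc _ _ ((continuous_subtype_val.tendsto x).comp hu)) hzero hr hX

end Estimation

end HiddenTranslation

end
-- The theorem.
open HiddenTranslation in
theorem theorem3 {d : ℕ} {Ω : Type*} [MeasurableSpace Ω] (Pr : Measure Ω) [IsProbabilityMeasure Pr]
    -- the hidden translation model
    (X ε : ℕ → Ω → E d) (Rstar : PairLaw d) (Pstar : ProbabilityMeasure (E d))
    (hmodel : IsTranslationModel Pr X ε Rstar Pstar)
    -- the compact neighborhood of 0 and the weight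
    (S : Set (E d × E d)) (hS : IsCompact S) (hS0 : S ∈ 𝓝 0)
    (hSproj : ∀ t ∈ S, (t.1, 0) ∈ S ∧ (0, t.2) ∈ S)
    (w : E d × E d → ℝ) (hw : ∀ t ∈ S, 0 < w t) (hwint : IntegrableOn w S)
    -- the class of candidate laws
    (𝓡 : Set (PairLaw d)) (ρ : ℝ) (hρ0 : 0 < ρ) (hρ2 : ρ < 2)
    (h𝓡 : ∀ R ∈ 𝓡, LightTail ρ (R : Measure (E d × E d)).fst ∧
      LightTail ρ (R : Measure (E d × E d)).snd ∧ Dependency R)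
    -- the estimator of the characteristic function and the least squares estimator
    (Φhat : ℕ → (ℕ → E d) → E d × E d → ℂ) (hΦhat : ∀ n y, Measurable (Φhat n y))
    (Rhat : ℕ → Ω → 𝓡)
    (hRhat : ∀ n, 1 ≤ n → ∀ ω, empCrit S w (Φhat n (obs X ε ω)) (Rhat n ω : PairLaw d) =
      ⨅ R ∈ 𝓡, empCrit S w (Φhat n (obs X ε ω)) R)
    -- the sup-norm of the normalized process is bounded in probability
    (hZ : IsBigOInProb Pr (fun n ω => ⨆ t ∈ S, ‖Z Rstar Pstar n (Φhat n (obs X ε ω)) t‖ₑ)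
      (fun _ => 1))
    -- the model is well specified
    (hRstar : Rstar ∈ 𝓡) :
    IsBigOInProb Pr (fun n ω => crit S w Rstar Pstar (Rhat n ω : PairLaw d))
        (fun n => (n : ℝ) ^ (-(1 / 2) : ℝ)) ∧
      (IsCompact 𝓡 →
        (∀ R ∈ 𝓡, (R : Measure (E d × E d)).fst = (R : Measure (E d × E d)).snd) →
        ∀ D : MetricSpace 𝓡, MetrizesWeakConvergence 𝓡 D →
          TendstoInMeasure Pr
            (fun n ω => distToSet D (Rhat n ω) {R | EqUpToTranslation (R : PairLaw d) Rstar})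
            atTop (fun _ => (0 : ℝ))) := by
  -- Minimality is used only against the competitor `Rstar`.
  have hbig := IsBigOInProb.crit (Rhat := fun n ω => (Rhat n ω : PairLaw d))
    (ψ := fun n ω => Φhat n (obs X ε ω)) hS hSproj hw hwint
    (fun n hn ω => (hRhat n hn ω).trans_le (iInf₂_le Rstar hRstar)) hZ
  refine ⟨hbig, fun hcomp hmarg D hD => ?_⟩
  obtain ⟨h₁', h₂', hdep'⟩ := h𝓡 Rstar hRstar
  refine tendstoInMeasure_distToSet (c := crit S w Rstar Pstar) (X := Rhat) hcomp D hD
    (fun u R hu => crit_le_liminf hwint Rstar Pstar hu) (fun R hcrit => ?_)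
    (r := fun n => (n : ℝ) ^ (-(1 / 2) : ℝ)) ?_ hbig
  · obtain ⟨h₁, h₂, hdep⟩ := h𝓡 R R.2
    exact eqUpToTranslation_of_crit_eq_zero hS0 hw hwint Pstar hρ0 hρ2 h₁ h₂ h₁' h₂'
      (hmarg R R.2) (hmarg Rstar hRstar) hdep hdep' hcrit
  · exact (tendsto_rpow_neg_atTop (by norm_num : (0 : ℝ) < 1 / 2)).comp tendsto_natCast_atTop_atTop
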